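/- All graphs are simple and connected (with a non-empty, possibly infinite, vertex set). A graph $G$ is regarded as a geodesic metric space: every edge is identified with the interval $[0,1]$, the points of $G$ are its vertices and the interior points of its edges, and the distance between two points is the length of a shortest path joining them. For a metric space $X$, a geodesic is a curve $\gamma:[a,b]\to X$ with $d(\gamma(s),\gamma(t))=|s-t|$ for all $s,t\in[a,b]$. A geodesic triangle $T$ in $X$ consists of three points (not necessarily distinct) and three sides, which are geodesics joining them in pairs; $\delta(T)$ is the infimum of all $\delta\ge 0$ such that every point of each side is at distance at most $\delta$ from the union of the other two sides. The hyperbolicity constant is $\delta(X)=\sup\{\delta(T): T \text{ a geodesic triangle in } X\}\in[0,\infty]$. The lexicographic product $G_1\circ G_2$ of two graphs has vertex set $V(G_1)\times V(G_2)$, and $(u_1,v_1)$ and $(u_2,v_2)$ are adjacent if either $u_1u_2\in E(G_1)$, or $u_1=u_2$ and $v_1v_2\in E(G_2)$. **Theorem.** Let $G_1$ be a connected graph with at least two vertices and let $G_2$ be any connected graph. Then $$\delta(G_1)\le \delta(G_1\circ G_2)\le \delta(G_1)+\tfrac32,$$ as an inequality in $[0,\infty]$ (so, in particular, $\delta(G_1\circ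 G_2)=\infty$ if $\delta(G_1)=\infty$). -/

import Mathlib

open scoped NNReal ENNReal

section Hyperbolicity

/-- The curve `γ : [a, b] → X` is a geodesic (parametrized by arc length). -/
def IsGeodesicOn {X : Type*} [MetricSpace X] (γ : ℝ → X) (a b : ℝ) : Prop :=
  a ≤ b ∧ ∀ s ∈ Set.Icc a b, ∀ t ∈ Set.Icc a b, dist (γ s) (γ t) = |s - t|

/-- The set `S` is (the image of) a geodesic `[xy]` joining `x` and `y`. -/
def IsGeodesicJoining {X : Type*} [MetricSpace X] (S : Set X) (x y : X) : Prop :=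
  ∃ (γ : ℝ → X) (a b : ℝ), IsGeodesicOn γ a b ∧ γ a = x ∧ γ b = y ∧ S = γ '' Set.Icc a b

/-- A geodesic triangle: three points (not necessarily distinct) together with a choice of
geodesics joining them. The side `i` joins the points `i` and `i + 1` modulo 3. -/
structure GeodesicTriangle (X : Type*) [MetricSpace X] where
  point : Fin 3 → X
  side : Fin 3 → Set X
  isGeodesic : ∀ i, IsGeodesicJoining (side i) (point i) (point (i + 1))

/-- The triangle is `δ`-thin: each point of a side is at distance at most `δ` from the union of
the two other sides. -/
def GeodesicTriangle.IsThin {X : Type*} [MetricSpace X] (T : GeodesicTriangle X) (δ : ℝ≥0) :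
    Prop :=
  ∀ i, ∀ p ∈ T.side i, Metric.infDist p (⋃ (j : Fin 3) (_ : j ≠ i), T.side j) ≤ δ

/-- The sharp thin constant `δ(T) = inf {δ ≥ 0 : T is δ-thin}`. -/
noncomputable def GeodesicTriangle.thinConst {X : Type*} [MetricSpace X]
    (T : GeodesicTriangle X) : ℝ≥0∞ :=
  ⨅ (δ : ℝ≥0) (_ : T.IsThin δ), (δ : ℝ≥0∞)

/-- The sharp hyperbolicity constant `δ(X) = sup {δ(T) : T a geodesic triangle in X} ∈ [0, ∞]`. -/
noncomputable def hyperbolicityConst (X : Type*) [MetricSpace X] : ℝ≥0∞ :=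
  ⨆ T : GeodesicTriangle X, T.thinConst

end Hyperbolicity

section MetricGraphs

/-- Coordinates of a point of a connected graph `G` all of whose edges have length 1. Either
`fst = snd` and `pos = 0`, and this is the vertex `fst`, or `[fst, snd]` is an edge and this is
the point of the edge at distance `pos` from `fst` and `1 - pos` from `snd`. Different coordinates
may describe the same point. -/
structure GraphCoord {V : Type*} {G : SimpleGraph V} (hG : G.Connected) where
  fst : V
  snd : V
  pos : ℝ
  valid : (fst = snd ∧ pos = 0) ∨ (G.Adj fst snd ∧ 0 ≤ pos ∧ pos ≤ 1)

namespace GraphCoord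

variable {V : Type*} {G : SimpleGraph V} {hG : G.Connected}

/-- Length of a shortest path from the point `x` to the vertex `w`: leave the edge of `x` through
one of its ends and follow a shortest walk. -/
noncomputable def vdist (x : GraphCoord hG) (w : V) : ℝ :=
  min (x.pos + G.dist x.fst w) ((1 - x.pos) + G.dist x.snd w)

open Classical in
/-- Length of a shortest path between two points: along the edge if both lie on the same edge
(with the same or with the opposite orientation), and otherwise through an end of the edge of
`x` and an end of the edge of `y`. -/
noncomputable def pathDist (x y : GraphCoord hG) : ℝ :=
  if x.fst = y.fst ∧ x.snd = y.snd then |x.pos - y.pos|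
  else if x.fst = y.snd ∧ x.snd = y.fst then |x.pos - (1 - y.pos)|
  else min (x.vdist y.fst + y.pos) (x.vdist y.snd + (1 - y.pos))

theorem pos_nonneg (x : GraphCoord hG) : 0 ≤ x.pos := by
  rcases x.valid with h | h
  · exact h.2.ge
  · exact h.2.1

theorem pos_le_one (x : GraphCoord hG) : x.pos ≤ 1 := by
  rcases x.valid with h | h
  · rw [h.2]; exact zero_le_one
  · exact h.2.2

theorem dist_triangle_real (hG : G.Connected) (u v w : V) :
    (G.dist u w : ℝ) ≤ G.dist u v + G.dist v w := by
  exact_mod_cast hG.dist_triangle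

theorem dist_ends_le (x : GraphCoord hG) : (G.dist x.fst x.snd : ℝ) ≤ 1 := by
  rcases x.valid with h | h
  · rw [h.1]; simp
  · rw [SimpleGraph.dist_eq_one_iff_adj.2 h.1]; simp

theorem pos_le_dist_ends (x : GraphCoord hG) : x.pos ≤ G.dist x.fst x.snd := by
  rcases x.valid with h | h
  · rw [h.2]; exact Nat.cast_nonneg _
  · rw [SimpleGraph.dist_eq_one_iff_adj.2 h.1]; simpa using h.2.2

theorem vdist_le_add (x : GraphCoord hG) (v w : V) :
    x.vdist w ≤ x.vdist v + G.dist v w := by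
  have h1 := dist_triangle_real hG x.fst v w
  have h2 := dist_triangle_real hG x.snd v w
  unfold vdist
  rcases min_cases (x.pos + (G.dist x.fst v : ℝ)) ((1 - x.pos) + G.dist x.snd v) with h | h <;>
    rcases min_cases (x.pos + (G.dist x.fst w : ℝ)) ((1 - x.pos) + G.dist x.snd w) with h' | h' <;>
    linarith

theorem dist_fst_le (x : GraphCoord hG) (w : V) : (G.dist x.fst w : ℝ) ≤ x.pos + x.vdist w := by
  have h1 := dist_triangle_real hG x.fst x.snd w
  have h2 := x.dist_ends_le
  have h3 := x.pos_nonneg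
  unfold vdist
  rcases min_cases (x.pos + (G.dist x.fst w : ℝ)) ((1 - x.pos) + G.dist x.snd w) with h | h <;>
    linarith

theorem dist_snd_le (x : GraphCoord hG) (w : V) :
    (G.dist x.snd w : ℝ) ≤ (1 - x.pos) + x.vdist w := by
  have h1 := dist_triangle_real hG x.snd x.fst w
  have h2 := x.dist_ends_le
  rw [SimpleGraph.dist_comm] at h2
  have h3 := x.pos_le_one
  unfold vdist
  rcases min_cases (x.pos + (G.dist x.fst w : ℝ)) ((1 - x.pos) + G.dist x.snd w) with h | h <;>
    linarith

theorem vdist_fst_le (x : GraphCoord hG) : x.vdist x.fst ≤ x.pos := by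
  unfold vdist
  refine (min_le_left _ _).trans ?_
  simp

theorem vdist_snd_le (x : GraphCoord hG) : x.vdist x.snd ≤ 1 - x.pos := by
  unfold vdist
  refine (min_le_right _ _).trans ?_
  simp

theorem vdist_le_pathDist_add (x y : GraphCoord hG) (w : V) :
    x.vdist w ≤ x.pathDist y + y.vdist w := by
  unfold pathDist
  split_ifs with h h'
  · have h1 := le_abs_self (x.pos - y.pos)
    have h2 := neg_abs_le (x.pos - y.pos)
    unfold vdist
    rw [h.1, h.2, ← min_add_add_left]
    exact le_min ((min_le_left _ _).trans (by linarith)) ((min_le_right _ _).trans (by linarith))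
  · have h1 := le_abs_self (x.pos - (1 - y.pos))
    have h2 := neg_abs_le (x.pos - (1 - y.pos))
    unfold vdist
    rw [h'.1, h'.2, ← min_add_add_left]
    exact le_min ((min_le_right _ _).trans (by linarith)) ((min_le_left _ _).trans (by linarith))
  · rw [← min_add_add_right]
    refine le_min ?_ ?_
    · linarith [x.vdist_le_add y.fst w, y.dist_fst_le w]
    · linarith [x.vdist_le_add y.snd w, y.dist_snd_le w]

theorem pathDist_le_vdist_add (x y : GraphCoord hG) (w : V) :
    x.pathDist y ≤ x.vdist w + y.vdist w := by
  have hx0 := x.pos_nonneg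
  have hx1 := x.pos_le_one
  have hy0 := y.pos_nonneg
  have hy1 := y.pos_le_one
  have d0 : (G.dist y.fst y.snd : ℝ) ≤ G.dist y.fst w + G.dist y.snd w := by
    have := dist_triangle_real hG y.fst w y.snd
    rwa [SimpleGraph.dist_comm (u := w)] at this
  have dx : x.fst = y.fst ∧ x.snd = y.snd → x.pos ≤ G.dist y.fst y.snd := by
    intro h
    rw [← h.1, ← h.2]
    exact x.pos_le_dist_ends
  have dy := y.pos_le_dist_ends
  have d1 : (0 : ℝ) ≤ G.dist y.fst w := Nat.cast_nonneg _
  have d2 : (0 : ℝ) ≤ G.dist y.snd w := Nat.cast_nonneg _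
  unfold pathDist
  split_ifs with h h'
  · have dx := dx h
    unfold vdist
    rw [h.1, h.2]
    rcases min_choice (x.pos + (G.dist y.fst w : ℝ)) ((1 - x.pos) + G.dist y.snd w) with e | e <;>
      rcases min_choice (y.pos + (G.dist y.fst w : ℝ)) ((1 - y.pos) + G.dist y.snd w) with f | f <;>
      rw [e, f] <;> refine abs_le.2 ⟨?_, ?_⟩ <;> linarith
  · have hy : (G.dist y.fst y.snd : ℝ) = 1 := by
      rcases y.valid with k | k
      · exact absurd ⟨h'.1.trans k.1.symm, h'.2.trans k.1⟩ h
      · rw [SimpleGraph.dist_eq_one_iff_adj.2 k.1]; simp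
    unfold vdist
    rw [h'.1, h'.2]
    rcases min_choice (x.pos + (G.dist y.snd w : ℝ)) ((1 - x.pos) + G.dist y.fst w) with e | e <;>
      rcases min_choice (y.pos + (G.dist y.fst w : ℝ)) ((1 - y.pos) + G.dist y.snd w) with f | f <;>
      rw [e, f] <;> refine abs_le.2 ⟨?_, ?_⟩ <;> linarith
  · have h1 := x.vdist_le_add w y.fst
    have h2 := x.vdist_le_add w y.snd
    rw [SimpleGraph.dist_comm] at h1 h2
    rcases min_choice (y.pos + (G.dist y.fst w : ℝ)) ((1 - y.pos) + G.dist y.snd w) with e | e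
    · refine (min_le_left _ _).trans ?_
      have : y.vdist w = _ := e
      linarith
    · refine (min_le_right _ _).trans ?_
      have : y.vdist w = _ := e
      linarith

theorem pathDist_self (x : GraphCoord hG) : x.pathDist x = 0 := by
  simp [pathDist]

theorem pathDist_comm (x y : GraphCoord hG) : x.pathDist y = y.pathDist x := by
  by_cases h : x.fst = y.fst ∧ x.snd = y.snd
  · unfold pathDist
    rw [if_pos h, if_pos ⟨h.1.symm, h.2.symm⟩, abs_sub_comm]
  have h' : ¬(y.fst = x.fst ∧ y.snd = x.snd) := fun k => h ⟨k.1.symm, k.2.symm⟩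
  by_cases k : x.fst = y.snd ∧ x.snd = y.fst
  · unfold pathDist
    rw [if_neg h, if_neg h', if_pos k, if_pos ⟨k.2.symm, k.1.symm⟩]
    congr 1
    ring
  have k' : ¬(y.fst = x.snd ∧ y.snd = x.fst) := fun l => k ⟨l.2.symm, l.1.symm⟩
  unfold pathDist
  rw [if_neg h, if_neg h', if_neg k, if_neg k']
  unfold vdist
  simp only [← min_add_add_right]
  rw [SimpleGraph.dist_comm (u := x.fst) (v := y.fst),
    SimpleGraph.dist_comm (u := x.snd) (v := y.fst),
    SimpleGraph.dist_comm (u := x.fst) (v := y.snd),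
    SimpleGraph.dist_comm (u := x.snd) (v := y.snd), min_min_min_comm]
  congr 2 <;> ring

/-- Either both points are given on the same edge, with the same or with the opposite orientation,
or a shortest path between them passes through a vertex. -/
theorem same_or_opp_or_vertex (x y : GraphCoord hG) :
    (x.fst = y.fst ∧ x.snd = y.snd ∧ x.pathDist y = |x.pos - y.pos|) ∨
      (x.fst = y.snd ∧ x.snd = y.fst ∧ x.pathDist y = |x.pos - (1 - y.pos)|) ∨
      ∃ w, x.vdist w + y.vdist w ≤ x.pathDist y := by
  by_cases h : x.fst = y.fst ∧ x.snd = y.snd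
  · exact Or.inl ⟨h.1, h.2, if_pos h⟩
  by_cases k : x.fst = y.snd ∧ x.snd = y.fst
  · refine Or.inr (Or.inl ⟨k.1, k.2, ?_⟩)
    unfold pathDist
    rw [if_neg h, if_pos k]
  refine Or.inr (Or.inr ?_)
  unfold pathDist
  rw [if_neg h, if_neg k]
  rcases min_choice (x.vdist y.fst + y.pos) (x.vdist y.snd + (1 - y.pos)) with e | e
  · exact ⟨y.fst, by rw [e]; linarith [y.vdist_fst_le]⟩
  · exact ⟨y.snd, by rw [e]; linarith [y.vdist_snd_le]⟩

theorem pathDist_triangle (x y z : GraphCoord hG) :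
    x.pathDist z ≤ x.pathDist y + y.pathDist z := by
  have key1 : (∃ w, x.vdist w + y.vdist w ≤ x.pathDist y) →
      x.pathDist z ≤ x.pathDist y + y.pathDist z := by
    rintro ⟨w, hw⟩
    have h1 := z.vdist_le_pathDist_add y w
    rw [pathDist_comm] at h1
    linarith [x.pathDist_le_vdist_add z w]
  have key2 : (∃ w, y.vdist w + z.vdist w ≤ y.pathDist z) →
      x.pathDist z ≤ x.pathDist y + y.pathDist z := by
    rintro ⟨w, hw⟩
    linarith [x.vdist_le_pathDist_add y w, x.pathDist_le_vdist_add z w]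
  rcases y.valid with hy | hy
  · refine key1 ⟨y.fst, ?_⟩
    have h1 := x.vdist_le_pathDist_add y y.fst
    have h2 := y.vdist_fst_le
    linarith [hy.2]
  have hne := hy.1.ne
  rcases x.same_or_opp_or_vertex y with ⟨a, b, h⟩ | ⟨a, b, h⟩ | h
  · rcases y.same_or_opp_or_vertex z with ⟨c, d, k⟩ | ⟨c, d, k⟩ | k
    · have l : x.pathDist z = |x.pos - z.pos| := if_pos ⟨a.trans c, b.trans d⟩
      rw [h, k, l]
      exact abs_sub_le _ _ _
    · have l : x.pathDist z = |x.pos - (1 - z.pos)| := by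
        unfold pathDist
        rw [if_neg (fun e => hne (a.symm.trans (e.1.trans d.symm))), if_pos ⟨a.trans c, b.trans d⟩]
      rw [h, k, l]
      exact abs_sub_le _ _ _
    · exact key2 k
  · rcases y.same_or_opp_or_vertex z with ⟨c, d, k⟩ | ⟨c, d, k⟩ | k
    · have l : x.pathDist z = |x.pos - (1 - z.pos)| := by
        unfold pathDist
        rw [if_neg (fun e => hne (c.trans (e.1.symm.trans a))), if_pos ⟨a.trans d, b.trans c⟩]
      have e := abs_sub_le x.pos (1 - y.pos) (1 - z.pos)
      have f : (1 - y.pos) - (1 - z.pos) = -(y.pos - z.pos) := by ring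
      rw [f, abs_neg] at e
      rwa [h, k, l]
    · have l : x.pathDist z = |x.pos - z.pos| := if_pos ⟨a.trans d, b.trans c⟩
      have e := abs_sub_le x.pos (1 - y.pos) z.pos
      have f : (1 - y.pos) - z.pos = -(y.pos - (1 - z.pos)) := by ring
      rw [f, abs_neg] at e
      rwa [h, k, l]
    · exact key2 k
  · exact key1 h

noncomputable instance : PseudoMetricSpace (GraphCoord hG) where
  dist := pathDist
  dist_self := pathDist_self
  dist_comm := pathDist_comm
  dist_triangle := pathDist_triangle

end GraphCoord

/-- The connected graph `G` as a metric space, every edge being isometric to `[0, 1]`: coordinates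
at distance zero are identified, so that the points are the vertices and the interior points of
the edges. -/
abbrev MetricGraph {V : Type*} {G : SimpleGraph V} (hG : G.Connected) : Type _ :=
  SeparationQuotient (GraphCoord hG)

end MetricGraphs

section LexicographicProduct

/-- The lexicographic product `G₁ ∘ G₂`. -/
def lexProd {V₁ V₂ : Type*} (G₁ : SimpleGraph V₁) (G₂ : SimpleGraph V₂) :
    SimpleGraph (V₁ × V₂) where
  Adj p q := G₁.Adj p.1 q.1 ∨ (p.1 = q.1 ∧ G₂.Adj p.2 q.2)
  symm := ⟨by
    rintro p q (h | h)
    · exact Or.inl h.symm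
    · exact Or.inr ⟨h.1.symm, h.2.symm⟩⟩
  loopless := ⟨by
    rintro p (h | h)
    · exact h.ne rfl
    · exact h.2.ne rfl⟩

theorem lexProd_connected {V₁ V₂ : Type*} {G₁ : SimpleGraph V₁} {G₂ : SimpleGraph V₂}
    (h₁ : G₁.Connected) (h₂ : G₂.Connected) : (lexProd G₁ G₂).Connected := by
  have := h₁.nonempty
  have := h₂.nonempty
  refine { preconnected := ?_ }
  rintro ⟨u, v⟩ ⟨u', v'⟩
  have a : (lexProd G₁ G₂).Reachable (u, v) (u, v') :=
    (h₂.preconnected v v').map (⟨fun w => (u, w), fun h => Or.inr ⟨rfl, h⟩⟩ :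
      G₂ →g lexProd G₁ G₂)
  have b : (lexProd G₁ G₂).Reachable (u, v') (u', v') :=
    (h₁.preconnected u u').map (⟨fun w => (w, v'), fun h => Or.inl h⟩ :
      G₁ →g lexProd G₁ G₂)
  exact a.trans b

end LexicographicProduct

/-! For the lower bound, each copy `G₁ × {v}` sits isometrically in the product, and geodesic
triangles push forward along an isometry.

For the upper bound, let π be the projection to `G₁` that collapses every edge inside a fiber. Its
only defect is the depth of a point, the distance to the nearest end when the point lies on a fiber
edge; this is at most 1/2. Two estimates control everything: π is 1-Lipschitz and collapses the ball
of radius depth around a point (`dist_proj_le`), while d(x, y) ≤ max(2, d(πx, πy)) + depth x + depth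
y (`dist_le_max_dist_proj`). The 2 appears because two vertices of one fiber are joined through any
neighbouring fiber; vertices of different fibers are exactly as far apart as their projections.
Hence a geodesic whose ends project to points more than 2 apart becomes a geodesic of `G₁` once the
collapsed parts at its ends are trimmed.

Let P lie on a side XY. If P is within 3/2 of X or Y there is nothing to do. Otherwise the side
projects to a geodesic through πP, and P has depth 0. Each other side is replaced by a geodesic of
`G₁` between the projected ends, such that a point q of it yields a point r of the original side
with d(P, r) ≤ d(πP, q) + 3/2 (`exists_geodesic_near`). The hyperbolicity of `G₁` then supplies q.
The replacement rests on vertices of the side: a vertex whose fiber contains no end of the edge of P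
is as far from P as its projection is from πP, and in the exceptional fibers the side has a vertex
within 3/2 of P (`exists_dist_le_of_vertex_mem`). -/

/-! ### Geodesics and thin triangles in metric spaces. -/

section MetricGeodesics

variable {X Y : Type*} [MetricSpace X] [MetricSpace Y]

/-- A curve that does not increase distances and whose ends are as far apart as possible is a
geodesic. -/
theorem IsGeodesicOn.of_dist_le {γ : ℝ → X} {a b : ℝ} (hab : a ≤ b)
    (h : ∀ s t, a ≤ s → s ≤ t → t ≤ b → dist (γ s) (γ t) ≤ t - s)
    (hd : b - a ≤ dist (γ a) (γ b)) : IsGeodesicOn γ a b := by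
  -- A shortfall between `s` and `t` would make the route from `γ a` to `γ b` through them shorter
  -- than `b - a`.
  have key : ∀ s t, a ≤ s → s ≤ t → t ≤ b → dist (γ s) (γ t) = t - s := by
    intro s t hs hst ht
    refine le_antisymm (h s t hs hst ht) ?_
    have h1 := h a s le_rfl hs (hst.trans ht)
    have h2 := h t b (hs.trans hst) ht le_rfl
    have h3 := dist_triangle4 (γ a) (γ s) (γ t) (γ b)
    linarith
  refine ⟨hab, fun s hs t ht => ?_⟩
  rcases le_total s t with hst | hst
  · rw [key s t hs.1 hst ht.2, abs_sub_comm, abs_of_nonneg (by linarith)]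
  · rw [dist_comm, key t s ht.1 hst hs.2, abs_of_nonneg (by linarith)]

theorem IsGeodesicOn.dist_eq {γ : ℝ → X} {a b s t : ℝ} (h : IsGeodesicOn γ a b)
    (hs : a ≤ s) (hst : s ≤ t) (ht : t ≤ b) : dist (γ s) (γ t) = t - s := by
  rw [h.2 s ⟨hs, hst.trans ht⟩ t ⟨hs.trans hst, ht⟩, abs_sub_comm, abs_of_nonneg (by linarith)]

theorem IsGeodesicOn.continuousOn {γ : ℝ → X} {a b : ℝ} (h : IsGeodesicOn γ a b) :
    ContinuousOn γ (Set.Icc a b) := by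
  refine LipschitzOnWith.continuousOn (K := 1) (LipschitzOnWith.of_dist_le_mul ?_)
  intro s hs t ht
  rw [h.2 s hs t ht, Real.dist_eq]
  simp

theorem IsGeodesicJoining.symm {S : Set X} {x y : X} (h : IsGeodesicJoining S x y) :
    IsGeodesicJoining S y x := by
  obtain ⟨γ, a, b, hγ, rfl, rfl, rfl⟩ := h
  refine ⟨fun t => γ (a + b - t), a, b, ⟨hγ.1, ?_⟩, by simp, by simp, ?_⟩
  · intro s hs t ht
    rw [hγ.2 _ ⟨by linarith [hs.2], by linarith [hs.1]⟩ _ ⟨by linarith [ht.2], by linarith [ht.1]⟩,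
      ← abs_neg]
    congr 1
    ring
  · ext q
    constructor
    · rintro ⟨t, ht, rfl⟩
      exact ⟨a + b - t, ⟨by linarith [ht.2], by linarith [ht.1]⟩, by simp⟩
    · rintro ⟨t, ht, rfl⟩
      exact ⟨a + b - t, ⟨by linarith [ht.2], by linarith [ht.1]⟩, rfl⟩

theorem IsGeodesicJoining.left_mem {S : Set X} {x y : X} (h : IsGeodesicJoining S x y) :
    x ∈ S := by
  obtain ⟨γ, a, b, hγ, rfl, rfl, rfl⟩ := h
  exact ⟨a, ⟨le_rfl, hγ.1⟩, rfl⟩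

theorem IsGeodesicJoining.right_mem {S : Set X} {x y : X} (h : IsGeodesicJoining S x y) :
    y ∈ S := h.symm.left_mem

/-- The side is a curve parametrized by `[0, dist x y]`. -/
theorem IsGeodesicJoining.exists_param {S : Set X} {x y : X} (h : IsGeodesicJoining S x y) :
    ∃ γ : ℝ → X, IsGeodesicOn γ 0 (dist x y) ∧ γ 0 = x ∧ γ (dist x y) = y ∧
      S = γ '' Set.Icc 0 (dist x y) := by
  obtain ⟨γ, a, b, hγ, rfl, rfl, rfl⟩ := h
  have hd : dist (γ a) (γ b) = b - a := hγ.dist_eq le_rfl hγ.1 le_rfl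
  rw [hd]
  refine ⟨fun t => γ (a + t), ⟨by linarith [hγ.1], ?_⟩, by simp, by simp, ?_⟩
  · intro s hs t ht
    rw [hγ.2 _ ⟨by linarith [hs.1], by linarith [hs.2]⟩ _ ⟨by linarith [ht.1], by linarith [ht.2]⟩]
    congr 1
    ring
  · ext q
    constructor
    · rintro ⟨t, ht, rfl⟩
      exact ⟨t - a, ⟨by linarith [ht.1], by linarith [ht.2]⟩, by simp⟩
    · rintro ⟨t, ht, rfl⟩
      exact ⟨a + t, ⟨by linarith [ht.1], by linarith [ht.2]⟩, rfl⟩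

/-- Each point of a geodesic divides the distance between its ends. -/
theorem IsGeodesicJoining.dist_add_dist {S : Set X} {x y q : X} (h : IsGeodesicJoining S x y)
    (hq : q ∈ S) : dist x q + dist q y = dist x y := by
  obtain ⟨γ, a, b, hγ, rfl, rfl, rfl⟩ := h
  obtain ⟨t, ht, rfl⟩ := hq
  rw [hγ.dist_eq le_rfl ht.1 ht.2, hγ.dist_eq ht.1 ht.2 le_rfl, hγ.dist_eq le_rfl hγ.1 le_rfl]
  ring

theorem IsGeodesicJoining.refl (x : X) : IsGeodesicJoining {x} x x :=
  ⟨fun _ => x, 0, 0, ⟨le_rfl, fun s hs t ht => by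
    have h1 : s = 0 := le_antisymm hs.2 hs.1
    have h2 : t = 0 := le_antisymm ht.2 ht.1
    simp [h1, h2]⟩, rfl, rfl, by simp⟩

/-- Geodesics can be concatenated if the distances of the ends add up. -/
theorem IsGeodesicJoining.concat {S T : Set X} {x y z : X} (h₁ : IsGeodesicJoining S x y)
    (h₂ : IsGeodesicJoining T y z) (h : dist x y + dist y z ≤ dist x z) :
    ∃ U : Set X, IsGeodesicJoining U x z := by
  obtain ⟨γ, hγ, hγx, hγy, -⟩ := h₁.exists_param
  obtain ⟨η, hη, hηy, hηz, -⟩ := h₂.exists_param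
  generalize dist x y = p at *
  generalize dist y z = q at *
  have hp : 0 ≤ p := hγ.1
  have hq : 0 ≤ q := hη.1
  set c : ℝ → X := fun t => if t ≤ p then γ t else η (t - p) with hc
  have c₁ : ∀ t, t ≤ p → c t = γ t := fun t ht => if_pos ht
  have c₂ : ∀ t, p ≤ t → c t = η (t - p) := by
    intro t ht
    rcases ht.eq_or_lt with rfl | ht
    · rw [c₁ _ le_rfl, hγy, sub_self, hηy]
    · exact if_neg ht.not_ge
  have c0 : c 0 = x := by rw [c₁ 0 hp, hγx]
  have cz : c (p + q) = z := by rw [c₂ _ (by linarith), add_sub_cancel_left, hηz]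
  refine ⟨_, c, 0, p + q, IsGeodesicOn.of_dist_le (by linarith) ?_ ?_, c0, cz, rfl⟩
  · intro s t hs hst ht
    rcases le_total t p with htp | htp
    · rw [c₁ s (hst.trans htp), c₁ t htp, hγ.dist_eq hs hst htp]
    rcases le_total p s with hps | hps
    · rw [c₂ s hps, c₂ t htp, hη.dist_eq (by linarith) (by linarith) (by linarith)]
      linarith
    · have e₁ := hγ.dist_eq hs hps le_rfl
      have e₂ := hη.dist_eq (s := 0) (t := t - p) le_rfl (by linarith) (by linarith)
      rw [c₁ s hps, c₂ t htp]
      have := dist_triangle (γ s) (γ p) (η (t - p))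
      rw [hηy] at e₂
      rw [hγy] at e₁ this
      linarith
  · rw [c0, cz]
    linarith

/-- Isometric embeddings do not decrease the hyperbolicity constant. -/
theorem hyperbolicityConst_le_of_isometry {f : X → Y} (hf : Isometry f) :
    hyperbolicityConst X ≤ hyperbolicityConst Y := by
  refine iSup_le fun T => ?_
  let T' : GeodesicTriangle Y :=
    { point := fun i => f (T.point i)
      side := fun i => f '' T.side i
      isGeodesic := by
        intro i
        obtain ⟨γ, a, b, hγ, ha, hb, hS⟩ := T.isGeodesic i
        refine ⟨f ∘ γ, a, b, ⟨hγ.1, fun s hs t ht => ?_⟩, ?_, ?_, ?_⟩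
        · rw [← hγ.2 s hs t ht]
          exact hf.dist_eq _ _
        · simp [ha]
        · simp [hb]
        · rw [hS, Set.image_comp] }
  refine le_trans ?_ (le_iSup (fun T : GeodesicTriangle Y => T.thinConst) T')
  refine le_iInf₂ fun δ hδ => iInf₂_le δ ?_
  intro i p hp
  have := hδ i (f p) ⟨p, hp, rfl⟩
  have e : (⋃ (j : Fin 3) (_ : j ≠ i), T'.side j) = f '' ⋃ (j : Fin 3) (_ : j ≠ i), T.side j := by
    simp only [Set.image_iUnion, T']
  rwa [e, Metric.infDist_image hf] at this

/-- The sides of a geodesic triangle are within the hyperbolicity constant of each other. -/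
theorem exists_dist_lt_of_hyperbolicityConst {x y z : X} {S₀ S₁ S₂ : Set X} {δ : ℝ≥0}
    (hδ : hyperbolicityConst X = δ) (h₀ : IsGeodesicJoining S₀ x y)
    (h₁ : IsGeodesicJoining S₁ y z) (h₂ : IsGeodesicJoining S₂ z x) {p : X} (hp : p ∈ S₀)
    {ε : ℝ} (hε : 0 < ε) : ∃ q ∈ S₁ ∪ S₂, dist p q < δ + ε := by
  let T : GeodesicTriangle X :=
    { point := ![x, y, z]
      side := ![S₀, S₁, S₂]
      isGeodesic := by
        intro i
        fin_cases i
        · exact h₀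
        · exact h₁
        · exact h₂ }
  have hT : T.thinConst ≤ δ := hδ ▸ le_iSup (fun T : GeodesicTriangle X => T.thinConst) T
  -- The slack `ε` is needed because the distance to the union of the other sides is an infimum.
  have hlt : T.thinConst < (δ + ε.toNNReal : ℝ≥0) :=
    hT.trans_lt (by exact_mod_cast lt_add_of_pos_right δ (Real.toNNReal_pos.2 hε))
  unfold GeodesicTriangle.thinConst at hlt
  simp only [iInf_lt_iff] at hlt
  obtain ⟨δ', hthin, hlt⟩ := hlt
  have hlt' : (δ' : ℝ) < δ + ε := by
    have : δ' < δ + ε.toNNReal := by exact_mod_cast hlt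
    have : (δ' : ℝ) < (δ + ε.toNNReal : ℝ≥0) := by exact_mod_cast this
    rwa [NNReal.coe_add, Real.coe_toNNReal _ hε.le] at this
  have hne : (⋃ (j : Fin 3) (_ : j ≠ 0), T.side j).Nonempty :=
    ⟨y, Set.mem_biUnion (show (1 : Fin 3) ∈ {j | j ≠ 0} by simp) h₁.left_mem⟩
  obtain ⟨q, hq, hd⟩ := (Metric.infDist_lt_iff hne).1 ((hthin 0 p hp).trans_lt hlt')
  refine ⟨q, ?_, hd⟩
  simp only [Set.mem_iUnion] at hq
  obtain ⟨j, hj, hq⟩ := hq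
  fin_cases j
  · exact absurd rfl hj
  · exact Or.inl hq
  · exact Or.inr hq

end MetricGeodesics

/-! ### Ends of edges and distances to vertices. -/

namespace GraphCoord

variable {V : Type*} {G : SimpleGraph V} {hG : G.Connected}

/-- The vertex `v` as a point. -/
def vertex (hG : G.Connected) (v : V) : GraphCoord hG := ⟨v, v, 0, Or.inl ⟨rfl, rfl⟩⟩

/-- The point of the edge `uv` at distance `t` from `u`. -/
def onEdge (hG : G.Connected) {u v : V} (h : G.Adj u v) (t : ℝ) (h₀ : 0 ≤ t) (h₁ : t ≤ 1) :
    GraphCoord hG := ⟨u, v, t, Or.inr ⟨h, h₀, h₁⟩⟩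

/-- The vertex `e` is an end of the edge of `x`, at distance (at most) `s` from `x`. -/
def IsEnd (x : GraphCoord hG) (e : V) (s : ℝ) : Prop :=
  (e = x.fst ∧ s = x.pos) ∨ (e = x.snd ∧ s = 1 - x.pos)

theorem dist_def (x y : GraphCoord hG) : dist x y = x.pathDist y := rfl

theorem isEnd_fst (x : GraphCoord hG) : x.IsEnd x.fst x.pos := Or.inl ⟨rfl, rfl⟩

theorem isEnd_snd (x : GraphCoord hG) : x.IsEnd x.snd (1 - x.pos) := Or.inr ⟨rfl, rfl⟩

theorem IsEnd.vdist_le {x : GraphCoord hG} {e : V} {s : ℝ} (h : x.IsEnd e s) (w : V) :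
    x.vdist w ≤ s + G.dist e w := by
  rcases h with ⟨rfl, rfl⟩ | ⟨rfl, rfl⟩
  · exact min_le_left _ _
  · exact min_le_right _ _

theorem exists_isEnd_vdist (x : GraphCoord hG) (w : V) :
    ∃ e s, x.IsEnd e s ∧ x.vdist w = s + G.dist e w := by
  rcases min_choice (x.pos + (G.dist x.fst w : ℝ)) ((1 - x.pos) + G.dist x.snd w) with h | h
  · exact ⟨_, _, x.isEnd_fst, h⟩
  · exact ⟨_, _, x.isEnd_snd, h⟩

theorem IsEnd.nonneg {x : GraphCoord hG} {e : V} {s : ℝ} (h : x.IsEnd e s) : 0 ≤ s := by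
  rcases h with ⟨rfl, rfl⟩ | ⟨rfl, rfl⟩
  · exact x.pos_nonneg
  · linarith [x.pos_le_one]

theorem IsEnd.dist_le {x y : GraphCoord hG} {e f : V} {s t : ℝ} (hx : x.IsEnd e s)
    (hy : y.IsEnd f t) : dist x y ≤ s + G.dist e f + t := by
  have h1 := x.pathDist_le_vdist_add y f
  have h2 := hx.vdist_le f
  have h3 := hy.vdist_le f
  rw [SimpleGraph.dist_self, Nat.cast_zero, add_zero] at h3
  rw [dist_def]
  linarith

theorem dist_vertex (x : GraphCoord hG) (w : V) : dist x (vertex hG w) = x.vdist w := by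
  have h0 : (vertex hG w).vdist w = 0 := by simp [vertex, vdist]
  have h1 := x.pathDist_le_vdist_add (vertex hG w) w
  have h2 := x.vdist_le_pathDist_add (vertex hG w) w
  rw [dist_def]
  linarith

theorem dist_vertex_vertex (v w : V) : dist (vertex hG v) (vertex hG w) = G.dist v w := by
  rw [dist_vertex]
  simp [vertex, vdist]

theorem dist_vertex_fst (x : GraphCoord hG) (h : x.pos = 0) : dist x (vertex hG x.fst) = 0 := by
  refine le_antisymm ?_ dist_nonneg
  rw [dist_vertex, ← h]
  exact x.vdist_fst_le

theorem dist_vertex_snd (x : GraphCoord hG) (h : x.pos = 1) : dist x (vertex hG x.snd) = 0 := by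
  refine le_antisymm ?_ dist_nonneg
  rw [dist_vertex]
  linarith [x.vdist_snd_le]

theorem dist_of_same {x y : GraphCoord hG} (h₁ : x.fst = y.fst) (h₂ : x.snd = y.snd) :
    dist x y = |x.pos - y.pos| := if_pos ⟨h₁, h₂⟩

theorem dist_of_opp {x y : GraphCoord hG} (hx : G.Adj x.fst x.snd) (h₁ : x.fst = y.snd)
    (h₂ : x.snd = y.fst) : dist x y = |x.pos - (1 - y.pos)| := by
  rw [dist_def]
  unfold pathDist
  rw [if_neg, if_pos ⟨h₁, h₂⟩]
  rintro ⟨h, -⟩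
  exact hx.ne (h.trans h₂.symm)

end GraphCoord

/-! ### Connected graphs as geodesic spaces. -/

namespace MetricGraph

open GraphCoord

variable {V : Type*} {G : SimpleGraph V} {hG : G.Connected}

/-- The point with the given coordinates. -/
noncomputable def mk (x : GraphCoord hG) : MetricGraph hG := SeparationQuotient.mk x

/-- Coordinates of a point. -/
noncomputable def coord (P : MetricGraph hG) : GraphCoord hG := Quotient.out P

@[simp]
theorem mk_coord (P : MetricGraph hG) : mk P.coord = P := Quotient.out_eq P

theorem dist_mk (x y : GraphCoord hG) : dist (mk x) (mk y) = dist x y :=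
  SeparationQuotient.dist_mk x y

theorem dist_coord (P Q : MetricGraph hG) : dist P.coord Q.coord = dist P Q := by
  rw [← dist_mk, mk_coord, mk_coord]

theorem mk_eq_mk {x y : GraphCoord hG} (h : dist x y ≤ 0) : mk x = mk y :=
  dist_le_zero.1 ((dist_mk x y).trans_le h)

theorem mk_eq_vertex_of_pos_eq_zero (x : GraphCoord hG) (h : x.pos = 0) :
    mk x = mk (vertex hG x.fst) := mk_eq_mk (x.dist_vertex_fst h).le

theorem mk_eq_vertex_of_pos_eq_one (x : GraphCoord hG) (h : x.pos = 1) :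
    mk x = mk (vertex hG x.snd) := mk_eq_mk (x.dist_vertex_snd h).le

/-- Points with coordinates on the same oriented edge are joined by a segment of the edge. -/
theorem exists_geodesic_of_same {x y : GraphCoord hG} (h₁ : x.fst = y.fst) (h₂ : x.snd = y.snd) :
    ∃ S, IsGeodesicJoining S (mk x) (mk y) := by
  wlog hxy : x.pos ≤ y.pos generalizing x y
  · obtain ⟨S, hS⟩ := this h₁.symm h₂.symm (le_of_not_ge hxy)
    exact ⟨S, hS.symm⟩
  rcases x.valid with hx | hx
  · have hy : y.pos = 0 := by
      rcases y.valid with hy | hy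
      · exact hy.2
      · exact absurd (h₁.symm.trans (hx.1.trans h₂)) hy.1.ne
    have : mk x = mk y := mk_eq_mk (by rw [dist_of_same h₁ h₂, hx.2, hy]; simp)
    rw [this]
    exact ⟨_, IsGeodesicJoining.refl _⟩
  -- The curve must be defined on all of ℝ, while coordinates carry a proof that the position lies
  -- in [0, 1]; the parameter is therefore clamped.
  have hc : ∀ t : ℝ, (0 : ℝ) ≤ max 0 (min 1 t) ∧ max 0 (min 1 t) ≤ (1 : ℝ) := fun t =>
    ⟨le_max_left _ _, max_le zero_le_one (min_le_left _ _)⟩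
  set γ : ℝ → MetricGraph hG := fun t => mk (onEdge hG hx.1 _ (hc t).1 (hc t).2)
  have hγ : ∀ s t, 0 ≤ s → s ≤ 1 → 0 ≤ t → t ≤ 1 → dist (γ s) (γ t) = |s - t| := by
    intro s t hs hs' ht ht'
    have e : dist (γ s) (γ t) = |max 0 (min 1 s) - max 0 (min 1 t)| := by
      rw [dist_mk]
      exact dist_of_same rfl rfl
    rw [e, min_eq_right hs', min_eq_right ht', max_eq_right hs, max_eq_right ht]
  have hend : ∀ z : GraphCoord hG, z.fst = x.fst → z.snd = x.snd → γ z.pos = mk z := by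
    intro z h h'
    refine mk_eq_mk ?_
    have e := dist_of_same (x := onEdge hG hx.1 _ (hc z.pos).1 (hc z.pos).2) h.symm h'.symm
    rw [e]
    have : max 0 (min 1 z.pos) = z.pos := by
      rw [min_eq_right z.pos_le_one, max_eq_right z.pos_nonneg]
    simp [onEdge, this]
  refine ⟨_, γ, x.pos, y.pos, ⟨hxy, ?_⟩, hend x rfl rfl, hend y h₁.symm h₂.symm, rfl⟩
  intro s hs t ht
  exact hγ s t (x.pos_nonneg.trans hs.1) (hs.2.trans y.pos_le_one) (x.pos_nonneg.trans ht.1)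
    (ht.2.trans y.pos_le_one)

/-- A point is joined to the ends of its edge by a segment. -/
theorem exists_geodesic_isEnd {x : GraphCoord hG} {e : V} {s : ℝ} (h : x.IsEnd e s) :
    ∃ S, IsGeodesicJoining S (mk x) (mk (vertex hG e)) := by
  rcases x.valid with hx | hx
  · have he : e = x.fst := by
      rcases h with h | h
      · exact h.1
      · exact h.1.trans hx.1.symm
    rw [he]
    exact exists_geodesic_of_same rfl hx.1.symm
  rcases h with ⟨rfl, rfl⟩ | ⟨rfl, rfl⟩
  -- The vertex is rewritten as an extreme position on the edge of `x`, so that both points have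
  -- coordinates on the same oriented edge.
  · have e := mk_eq_vertex_of_pos_eq_zero (onEdge hG hx.1 0 le_rfl zero_le_one) rfl
    change mk _ = mk (vertex hG x.fst) at e
    rw [← e]
    exact exists_geodesic_of_same rfl rfl
  · have e := mk_eq_vertex_of_pos_eq_one (onEdge hG hx.1 1 zero_le_one le_rfl) rfl
    change mk _ = mk (vertex hG x.snd) at e
    rw [← e]
    exact exists_geodesic_of_same rfl rfl

theorem exists_geodesic_vertex (v w : V) :
    ∃ S, IsGeodesicJoining S (mk (vertex hG v)) (mk (vertex hG w)) := by
  obtain ⟨p, hp⟩ := hG.exists_walk_length_eq_dist v w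
  induction p with
  | nil => exact ⟨_, IsGeodesicJoining.refl _⟩
  | @cons u v w h p ih =>
    have h1 : G.dist u v = 1 := SimpleGraph.dist_eq_one_iff_adj.2 h
    have h2 := hG.dist_triangle (u := u) (v := v) (w := w)
    have h3 := SimpleGraph.dist_le p
    rw [SimpleGraph.Walk.length_cons] at hp
    have h4 : p.length = G.dist v w := by omega
    obtain ⟨S, hS⟩ := ih h4
    obtain ⟨T, hT⟩ := exists_geodesic_isEnd (onEdge hG h 0 le_rfl zero_le_one).isEnd_snd
    rw [mk_eq_vertex_of_pos_eq_zero (onEdge hG h 0 le_rfl zero_le_one) rfl] at hT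
    refine hT.concat hS ?_
    simp only [dist_mk, dist_vertex_vertex]
    have : G.dist u v + G.dist v w ≤ G.dist u w := by omega
    exact_mod_cast this

/-- Connected graphs are geodesic metric spaces. -/
theorem exists_geodesic (P Q : MetricGraph hG) : ∃ S, IsGeodesicJoining S P Q := by
  have hv : ∀ (x : GraphCoord hG) (w : V), ∃ S, IsGeodesicJoining S (mk x) (mk (vertex hG w)) := by
    intro x w
    obtain ⟨e, s, he, hd⟩ := x.exists_isEnd_vdist w
    obtain ⟨S, hS⟩ := exists_geodesic_isEnd he
    obtain ⟨T, hT⟩ := exists_geodesic_vertex (hG := hG) e w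
    refine hS.concat hT ?_
    rw [dist_mk, dist_mk, dist_mk, dist_vertex_vertex, dist_vertex, dist_vertex]
    have := he.vdist_le e
    rw [SimpleGraph.dist_self, Nat.cast_zero] at this
    linarith
  rw [← mk_coord P, ← mk_coord Q]
  generalize P.coord = x
  generalize Q.coord = y
  rcases x.same_or_opp_or_vertex y with ⟨a, b, -⟩ | ⟨a, b, h⟩ | ⟨w, hw⟩
  · exact exists_geodesic_of_same a b
  · rcases y.valid with hy | hy
    · exact exists_geodesic_of_same (a.trans hy.1.symm) (b.trans hy.1)
    · let y' : GraphCoord hG :=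
        onEdge hG hy.1.symm (1 - y.pos) (by linarith [y.pos_le_one]) (by linarith [y.pos_nonneg])
      have : mk y = mk y' := mk_eq_mk (by
        rw [dist_of_opp (x := y) (y := y') hy.1 rfl rfl]
        simp [y', onEdge])
      rw [this]
      exact exists_geodesic_of_same a b
  · obtain ⟨S, hS⟩ := hv x w
    obtain ⟨T, hT⟩ := hv y w
    refine hS.concat hT.symm ?_
    rw [dist_comm (mk (vertex hG w))]
    simp only [dist_mk, dist_vertex]
    exact hw

/-- A geodesic of length one starting at `γ s` meets an end of the edge of `γ s`: a vertex at
distance `1 / 2` from the midpoint of that edge, unless `γ s` is a vertex itself. -/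
theorem exists_vertex_of_geodesic {γ : ℝ → MetricGraph hG} {a b s t : ℝ}
    (hγ : IsGeodesicOn γ a b) (hs : s ∈ Set.Icc a b) (ht : t ∈ Set.Icc a b) (hst : |s - t| = 1) :
    ∃ r ∈ Set.Icc a b, ∃ w, γ r = mk (vertex hG w) ∧ |s - r| ≤ 1 ∧
      (r = s ∨ ∃ m : GraphCoord hG, m.fst = (γ s).coord.fst ∧ m.snd = (γ s).coord.snd ∧
        m.pos = 1 / 2 ∧ dist m (vertex hG w) ≤ 1 / 2) := by
  have self : ∀ w, γ s = mk (vertex hG w) → ∃ r ∈ Set.Icc a b, ∃ w, γ r = mk (vertex hG w) ∧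
      |s - r| ≤ 1 ∧ (r = s ∨ ∃ m : GraphCoord hG, m.fst = (γ s).coord.fst ∧
        m.snd = (γ s).coord.snd ∧ m.pos = 1 / 2 ∧ dist m (vertex hG w) ≤ 1 / 2) :=
    fun w hw => ⟨s, hs, w, hw, by simp, Or.inl rfl⟩
  have hx : mk (γ s).coord = γ s := mk_coord _
  generalize hxe : (γ s).coord = x at *
  rcases x.valid with h | h
  · exact self _ (hx ▸ mk_eq_vertex_of_pos_eq_zero x h.2)
  rcases h.2.1.eq_or_lt' with h0 | h0
  · exact self _ (hx ▸ mk_eq_vertex_of_pos_eq_zero x h0)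
  rcases h.2.2.eq_or_lt with h1 | h1
  · exact self _ (hx ▸ mk_eq_vertex_of_pos_eq_one x h1)
  -- Along the geodesic the distance to the midpoint `m` starts below 1/2 and, one unit later, is at
  -- least 1/2; where it equals 1/2 the geodesic is at a vertex.
  set m : GraphCoord hG := onEdge hG h.1 (1 / 2) (by norm_num) (by norm_num) with hm
  have d1 : dist (mk m) (γ s) < 1 / 2 := by
    rw [← hx, dist_mk, dist_of_same (x := m) (y := x) rfl rfl, abs_lt]
    constructor <;> simp only [hm, onEdge] <;> linarith
  have d2 : 1 / 2 ≤ dist (mk m) (γ t) := by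
    have := dist_triangle (γ s) (mk m) (γ t)
    rw [hγ.2 s hs t ht, hst, dist_comm] at this
    linarith
  have hsub : Set.uIcc s t ⊆ Set.Icc a b := Set.uIcc_subset_Icc hs ht
  have hcont : ContinuousOn (fun r => dist (mk m) (γ r)) (Set.uIcc s t) :=
    (continuous_const.dist continuous_id).comp_continuousOn (hγ.continuousOn.mono hsub)
  obtain ⟨r, hr, hdr⟩ := intermediate_value_uIcc hcont
    (show (1 / 2 : ℝ) ∈ _ from Set.mem_uIcc.2 (Or.inl ⟨d1.le, d2⟩))
  replace hdr : dist (mk m) (γ r) = 1 / 2 := hdr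
  have hvert : ∃ w, γ r = mk (vertex hG w) := by
    rw [← mk_coord (γ r)] at hdr ⊢
    generalize (γ r).coord = y at *
    simp only [dist_mk] at hdr
    have hpos : y.pos = 0 ∨ y.pos = 1 := by
      have y0 := y.pos_nonneg
      have y1 := y.pos_le_one
      have hmp : m.pos = 1 / 2 := rfl
      -- A path from `m` has used up length 1/2 on reaching any vertex, so a path of total length
      -- 1/2 through an end of the edge of `y` must stop there.
      have hv : ∀ w, 1 / 2 ≤ m.vdist w := by
        intro w
        refine le_min ?_ ?_ <;> rw [hmp]
        · linarith [(Nat.cast_nonneg (G.dist m.fst w) : (0 : ℝ) ≤ _)]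
        · linarith [(Nat.cast_nonneg (G.dist m.snd w) : (0 : ℝ) ≤ _)]
      rw [dist_def] at hdr
      unfold pathDist at hdr
      split_ifs at hdr
      · rw [hmp] at hdr
        rcases abs_cases (1 / 2 - y.pos) with h | h
        · exact Or.inl (by linarith)
        · exact Or.inr (by linarith)
      · rw [hmp] at hdr
        rcases abs_cases (1 / 2 - (1 - y.pos)) with h | h
        · exact Or.inr (by linarith)
        · exact Or.inl (by linarith)
      · rcases min_choice (m.vdist y.fst + y.pos) (m.vdist y.snd + (1 - y.pos)) with h | h
        · exact Or.inl (by linarith [hv y.fst])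
        · exact Or.inr (by linarith [hv y.snd])
    rcases hpos with h | h
    · exact ⟨_, mk_eq_vertex_of_pos_eq_zero y h⟩
    · exact ⟨_, mk_eq_vertex_of_pos_eq_one y h⟩
  obtain ⟨w, hw⟩ := hvert
  refine ⟨r, hsub hr, w, hw, ?_, Or.inr ⟨m, rfl, rfl, rfl, ?_⟩⟩
  · rw [← hst, abs_sub_comm s t, abs_sub_comm s r]
    exact Set.abs_sub_left_of_mem_uIcc hr
  · rw [← dist_mk, ← hw]
    exact hdr.le

end MetricGraph

/-! ### Vertex distances in the lexicographic product. -/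

section LexicographicDistance

variable {V₁ V₂ : Type*} {G₁ : SimpleGraph V₁} {G₂ : SimpleGraph V₂}

theorem dist_fst_le_lexProd_dist (h₁ : G₁.Connected) (hL : (lexProd G₁ G₂).Connected)
    (p q : V₁ × V₂) : G₁.dist p.1 q.1 ≤ (lexProd G₁ G₂).dist p q := by
  obtain ⟨w, hw⟩ := hL.exists_walk_length_eq_dist p q
  rw [← hw]
  clear hw
  induction w with
  | nil => simp
  | @cons u v w h p ih =>
    have h1 := h₁.dist_triangle (u := u.1) (v := v.1) (w := w.1)
    rw [SimpleGraph.Walk.length_cons]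
    rcases h with h | h
    · have := SimpleGraph.dist_eq_one_iff_adj.2 h
      omega
    · rw [h.1]
      omega

/-- A walk of positive length in `G₁` lifts with both second coordinates prescribed: keep the
initial one and switch on the last edge. -/
theorem lexProd_dist_eq (h₁ : G₁.Connected) (hL : (lexProd G₁ G₂).Connected) {p q : V₁ × V₂}
    (hpq : p.1 ≠ q.1) : (lexProd G₁ G₂).dist p q = G₁.dist p.1 q.1 := by
  refine le_antisymm ?_ (dist_fst_le_lexProd_dist h₁ hL p q)
  have key : ∀ {u u' : V₁} (w : G₁.Walk u u'), 0 < w.length → ∀ v v',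
      (lexProd G₁ G₂).dist (u, v) (u', v') ≤ w.length := by
    intro u u' w
    induction w with
    | nil => simp
    | @cons u₀ u₁ u₂ h r ih =>
      intro _ v v'
      rcases Nat.eq_zero_or_pos r.length with h0 | h0
      · obtain rfl := SimpleGraph.Walk.eq_of_length_eq_zero h0
        have : (lexProd G₁ G₂).Adj (u₀, v) (u₁, v') := Or.inl h
        rw [SimpleGraph.dist_eq_one_iff_adj.2 this, SimpleGraph.Walk.length_cons]
        omega
      · have h1 := ih h0 v v'
        have : (lexProd G₁ G₂).Adj (u₀, v) (u₁, v) := Or.inl h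
        have h2 := SimpleGraph.dist_eq_one_iff_adj.2 this
        have h3 := hL.dist_triangle (u := (u₀, v)) (v := (u₁, v)) (w := (u₂, v'))
        rw [SimpleGraph.Walk.length_cons]
        omega
  obtain ⟨w, hw⟩ := h₁.exists_walk_length_eq_dist p.1 q.1
  rw [← hw]
  refine key w ?_ p.2 q.2
  rw [hw]
  exact h₁.pos_dist_of_ne hpq

/-- Step to a neighbouring fiber and back; this is where a second vertex of `G₁` is essential. -/
theorem lexProd_dist_le_two [Nontrivial V₁] (h₁ : G₁.Connected) (hL : (lexProd G₁ G₂).Connected)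
    {p q : V₁ × V₂} (hpq : p.1 = q.1) : (lexProd G₁ G₂).dist p q ≤ 2 := by
  obtain ⟨u, hu⟩ := h₁.preconnected.exists_adj_of_nontrivial p.1
  have a : (lexProd G₁ G₂).Adj p (u, p.2) := Or.inl hu
  have b : (lexProd G₁ G₂).Adj (u, p.2) q := Or.inl (hpq ▸ hu.symm)
  have h2 := SimpleGraph.dist_eq_one_iff_adj.2 a
  have h3 := SimpleGraph.dist_eq_one_iff_adj.2 b
  have := hL.dist_triangle (u := p) (v := (u, p.2)) (w := q)
  omega

theorem lexProd_dist_fiber (h₁ : G₁.Connected) (hL : (lexProd G₁ G₂).Connected) (u u' : V₁)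
    (v : V₂) : (lexProd G₁ G₂).dist (u, v) (u', v) = G₁.dist u u' := by
  by_cases h : u = u'
  · subst h
    simp
  · exact lexProd_dist_eq h₁ hL h

end LexicographicDistance

/-! ### The projection and the depth, in coordinates. -/

namespace GraphCoord

variable {V₁ V₂ : Type*} {G₁ : SimpleGraph V₁} {G₂ : SimpleGraph V₂}
  {hL : (lexProd G₁ G₂).Connected}

open Classical in
/-- The projection of the lexicographic product to its first factor, collapsing the edges within
the copies of the second factor. -/
noncomputable def proj (h₁ : G₁.Connected) (x : GraphCoord hL) : GraphCoord h₁ where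
  fst := x.fst.1
  snd := x.snd.1
  pos := if x.fst.1 = x.snd.1 then 0 else x.pos
  valid := by
    split_ifs with h
    · exact Or.inl ⟨h, rfl⟩
    · rcases x.valid with h' | ⟨h' | h', h''⟩
      · exact absurd (congrArg Prod.fst h'.1) h
      · exact Or.inr ⟨h', h''⟩
      · exact absurd h'.1 h

open Classical in
/-- The distance of a point in a copy of the second factor to the closest end of its edge, and
zero for the other points. -/
noncomputable def depth (x : GraphCoord hL) : ℝ :=
  if x.fst.1 = x.snd.1 then min x.pos (1 - x.pos) else 0

theorem depth_nonneg (x : GraphCoord hL) : 0 ≤ x.depth := by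
  unfold depth
  split_ifs
  · exact le_min x.pos_nonneg (by linarith [x.pos_le_one])
  · exact le_rfl

theorem depth_le_half (x : GraphCoord hL) : x.depth ≤ 1 / 2 := by
  unfold depth
  split_ifs
  · rcases le_total x.pos (1 / 2) with h | h
    · exact (min_le_left _ _).trans h
    · exact (min_le_right _ _).trans (by linarith)
  · norm_num

theorem depth_of_eq {x : GraphCoord hL} (h : x.fst.1 = x.snd.1) :
    x.depth = min x.pos (1 - x.pos) := if_pos h

theorem depth_of_ne {x : GraphCoord hL} (h : x.fst.1 ≠ x.snd.1) : x.depth = 0 := if_neg h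

theorem proj_pos_of_eq {h₁ : G₁.Connected} {x : GraphCoord hL} (h : x.fst.1 = x.snd.1) :
    (x.proj h₁).pos = 0 := if_pos h

theorem proj_pos_of_ne {h₁ : G₁.Connected} {x : GraphCoord hL} (h : x.fst.1 ≠ x.snd.1) :
    (x.proj h₁).pos = x.pos := if_neg h

theorem adj_of_ne {x : GraphCoord hL} (h : x.fst.1 ≠ x.snd.1) : G₁.Adj x.fst.1 x.snd.1 := by
  rcases x.valid with h' | ⟨h' | h', -⟩
  · exact absurd (congrArg Prod.fst h'.1) h
  · exact h'
  · exact absurd h'.1 h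

theorem IsEnd.fst_eq {x : GraphCoord hL} {e : V₁ × V₂} {s : ℝ} (h : x.IsEnd e s)
    (hx : x.fst.1 = x.snd.1) : e.1 = x.fst.1 := by
  rcases h with h | h
  · rw [h.1]
  · rw [h.1, hx]

theorem exists_isEnd_depth {x : GraphCoord hL} (hx : x.fst.1 = x.snd.1) :
    ∃ e, x.IsEnd e x.depth := by
  rw [depth_of_eq hx]
  rcases min_choice x.pos (1 - x.pos) with h | h <;> rw [h]
  · exact ⟨_, x.isEnd_fst⟩
  · exact ⟨_, x.isEnd_snd⟩

theorem IsEnd.exists_other {x : GraphCoord hL} {e : V₁ × V₂} {s : ℝ} (h : x.IsEnd e s)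
    (hx : x.fst.1 ≠ x.snd.1) : ∃ f, x.IsEnd f (1 - s) ∧ G₁.Adj e.1 f.1 := by
  rcases h with ⟨rfl, rfl⟩ | ⟨rfl, rfl⟩
  · exact ⟨_, x.isEnd_snd, adj_of_ne hx⟩
  · exact ⟨_, by simpa using x.isEnd_fst, (adj_of_ne hx).symm⟩

theorem lexProd_dist_eq_one (e f : V₁ × V₂) (h : G₁.Adj e.1 f.1) :
    ((lexProd G₁ G₂).dist e f : ℝ) = 1 := by
  have : (lexProd G₁ G₂).Adj e f := Or.inl h
  rw [SimpleGraph.dist_eq_one_iff_adj.2 this, Nat.cast_one]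

/-- Points whose edges have ends in a common copy of the second factor are close. -/
theorem dist_le_of_shared_end [Nontrivial V₁] (h₁ : G₁.Connected) {x y : GraphCoord hL}
    {e f : V₁ × V₂} {s t : ℝ} (hx : x.IsEnd e s) (hy : y.IsEnd f t) (hef : e.1 = f.1) :
    dist x y ≤ 2 + x.depth + y.depth := by
  have key : ∀ {x y : GraphCoord hL} {e f : V₁ × V₂} {s t : ℝ}, x.IsEnd e s → y.IsEnd f t →
      e.1 = f.1 → x.fst.1 = x.snd.1 → y.fst.1 ≠ y.snd.1 → dist x y ≤ 2 + x.depth + y.depth := by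
    intro x y e f s t hx hy hef hxv hyv
    obtain ⟨e', he'⟩ := exists_isEnd_depth hxv
    obtain ⟨f', hf', hadj⟩ := hy.exists_other hyv
    have h := he'.dist_le hf'
    rw [lexProd_dist_eq_one e' f' (by rwa [he'.fst_eq hxv, ← hx.fst_eq hxv, hef])] at h
    rw [depth_of_ne hyv]
    linarith [hy.nonneg]
  by_cases hxv : x.fst.1 = x.snd.1 <;> by_cases hyv : y.fst.1 = y.snd.1
  · obtain ⟨e', he'⟩ := exists_isEnd_depth hxv
    obtain ⟨f', hf'⟩ := exists_isEnd_depth hyv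
    have h := he'.dist_le hf'
    have h' : ((lexProd G₁ G₂).dist e' f' : ℝ) ≤ 2 := by
      exact_mod_cast lexProd_dist_le_two h₁ hL (p := e') (q := f')
        (by rw [he'.fst_eq hxv, ← hx.fst_eq hxv, hef, hy.fst_eq hyv, ← hf'.fst_eq hyv])
    linarith
  · exact key hx hy hef hxv hyv
  · rw [dist_comm]
    linarith [key hy hx hef.symm hyv hxv]
  · obtain ⟨e', he', hadj⟩ := hx.exists_other hxv
    obtain ⟨f', hf', hadj'⟩ := hy.exists_other hyv
    -- Both points lie on edges between fibers. The routes through `e'`, `f` and through `e`, `f'`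
    -- have lengths (1 - s) + 1 + t and s + 1 + (1 - t), with sum 4, so one of them is at most 2.
    have h := he'.dist_le hy
    have h' := hx.dist_le hf'
    rw [lexProd_dist_eq_one e' f (hef ▸ hadj.symm)] at h
    rw [lexProd_dist_eq_one e f' (hef ▸ hadj')] at h'
    linarith [x.depth_nonneg, y.depth_nonneg]

/-- Lifts the first step of a path in `G₁`: on a fiber edge both ends lie over `u`, and reaching the
nearer one costs the depth. -/
theorem exists_isEnd_of_proj {h₁ : G₁.Connected} {x : GraphCoord hL} {u : V₁} {s : ℝ}
    (h : (x.proj h₁).IsEnd u s) : ∃ e s', x.IsEnd e s' ∧ e.1 = u ∧ s' ≤ s + x.depth := by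
  by_cases hx : x.fst.1 = x.snd.1
  · obtain ⟨e, he⟩ := exists_isEnd_depth hx
    refine ⟨e, _, he, ?_, by linarith [h.nonneg]⟩
    rw [he.fst_eq hx]
    rcases h with h | h
    · exact h.1.symm
    · exact hx.trans h.1.symm
  · rw [depth_of_ne hx]
    rcases h with ⟨rfl, rfl⟩ | ⟨rfl, rfl⟩ <;> rw [proj_pos_of_ne hx]
    · exact ⟨_, _, x.isEnd_fst, rfl, by simp⟩
    · exact ⟨_, _, x.isEnd_snd, rfl, by simp⟩

/-- Distances in the lexicographic product are bounded through the first factor. -/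
theorem dist_le_max_dist_proj [Nontrivial V₁] (h₁ : G₁.Connected) (x y : GraphCoord hL) :
    dist x y ≤ max 2 (dist (x.proj h₁) (y.proj h₁)) + x.depth + y.depth := by
  by_cases hs : ∃ e f s t, x.IsEnd e s ∧ y.IsEnd f t ∧ e.1 = f.1
  · obtain ⟨e, f, s, t, hx, hy, hef⟩ := hs
    have := dist_le_of_shared_end h₁ hx hy hef
    linarith [le_max_left 2 (dist (x.proj h₁) (y.proj h₁))]
  refine le_trans ?_ (add_le_add_left (add_le_add_left (le_max_right _ _) _) _)
  rcases (x.proj h₁).same_or_opp_or_vertex (y.proj h₁) with ⟨h, -⟩ | ⟨h, -⟩ | ⟨w, hw⟩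
  · exact absurd ⟨_, _, _, _, x.isEnd_fst, y.isEnd_fst, h⟩ hs
  · exact absurd ⟨_, _, _, _, x.isEnd_fst, y.isEnd_snd, h⟩ hs
  · obtain ⟨u, s, hu, hsu⟩ := (x.proj h₁).exists_isEnd_vdist w
    obtain ⟨v, t, hv, htv⟩ := (y.proj h₁).exists_isEnd_vdist w
    obtain ⟨e, s', he, rfl, hs'⟩ := exists_isEnd_of_proj hu
    obtain ⟨f, t', hf, rfl, ht'⟩ := exists_isEnd_of_proj hv
    -- With no common fiber among the ends, the middle part of the path has the same length in both
    -- graphs.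
    have hef : e.1 ≠ f.1 := fun h => hs ⟨_, _, _, _, he, hf, h⟩
    have h := he.dist_le hf
    rw [lexProd_dist_eq h₁ hL hef] at h
    have h' := dist_triangle_real h₁ e.1 w f.1
    rw [SimpleGraph.dist_comm (u := w)] at h'
    rw [dist_def (x.proj h₁)]
    linarith

/-- A path from inside a fiber edge to a vertex first runs to an end of that edge, and the
projection does not see this part. -/
theorem vdist_proj_add_depth_le (h₁ : G₁.Connected) (x : GraphCoord hL) (w : V₁ × V₂) :
    (x.proj h₁).vdist w.1 + x.depth ≤ x.vdist w := by
  have d₁ : (G₁.dist x.fst.1 w.1 : ℝ) ≤ (lexProd G₁ G₂).dist x.fst w := by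
    exact_mod_cast dist_fst_le_lexProd_dist h₁ hL x.fst w
  have d₂ : (G₁.dist x.snd.1 w.1 : ℝ) ≤ (lexProd G₁ G₂).dist x.snd w := by
    exact_mod_cast dist_fst_le_lexProd_dist h₁ hL x.snd w
  have e₁ := (x.proj h₁).isEnd_fst.vdist_le w.1
  have e₂ := (x.proj h₁).isEnd_snd.vdist_le w.1
  change _ ≤ _ + (G₁.dist x.fst.1 w.1 : ℝ) at e₁
  change _ ≤ _ + (G₁.dist x.snd.1 w.1 : ℝ) at e₂
  by_cases hx : x.fst.1 = x.snd.1
  · rw [proj_pos_of_eq hx] at e₁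
    rw [depth_of_eq hx]
    rw [← hx] at d₂
    have m₁ := min_le_left x.pos (1 - x.pos)
    have m₂ := min_le_right x.pos (1 - x.pos)
    refine le_min ?_ ?_ <;> linarith
  · rw [proj_pos_of_ne hx] at e₁ e₂
    rw [depth_of_ne hx]
    refine le_min ?_ ?_ <;> linarith

/-- The projection does not increase distances, and collapses the ball of radius `x.depth`
around `x`. -/
theorem dist_proj_le (h₁ : G₁.Connected) (x y : GraphCoord hL) :
    dist (x.proj h₁) (y.proj h₁) ≤ max 0 (dist x y - x.depth) := by
  rcases x.same_or_opp_or_vertex y with ⟨a, b, h⟩ | ⟨a, b, h⟩ | ⟨w, hw⟩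
  · have h' : dist (x.proj h₁) (y.proj h₁) = |(x.proj h₁).pos - (y.proj h₁).pos| :=
      dist_of_same (congrArg Prod.fst a) (congrArg Prod.fst b)
    by_cases hx : x.fst.1 = x.snd.1
    · rw [h', proj_pos_of_eq hx, proj_pos_of_eq (x := y) (by rw [← a, hx, b])]
      simp
    · rw [h', proj_pos_of_ne hx, proj_pos_of_ne (x := y) (by rwa [← a, ← b]), depth_of_ne hx,
        dist_def, h, sub_zero]
      exact le_max_right _ _
  · by_cases hx : x.fst.1 = x.snd.1
    · have hy : y.fst.1 = y.snd.1 := by rw [← a, ← b, hx]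
      have h' : dist (x.proj h₁) (y.proj h₁) = |(x.proj h₁).pos - (y.proj h₁).pos| :=
        dist_of_same (hx.trans (congrArg Prod.fst b))
          (hx.symm.trans (congrArg Prod.fst a))
      rw [h', proj_pos_of_eq hx, proj_pos_of_eq hy]
      simp
    · have hy : y.fst.1 ≠ y.snd.1 := by
        rw [← a, ← b]
        exact Ne.symm hx
      have h' : dist (x.proj h₁) (y.proj h₁) = |(x.proj h₁).pos - (1 - (y.proj h₁).pos)| :=
        dist_of_opp (adj_of_ne hx) (congrArg Prod.fst a) (congrArg Prod.fst b)
      rw [h', proj_pos_of_ne hx, proj_pos_of_ne hy, depth_of_ne hx, dist_def, h, sub_zero]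
      exact le_max_right _ _
  · refine le_max_of_le_right ?_
    have := vdist_proj_add_depth_le h₁ x w
    have := vdist_proj_add_depth_le h₁ y w
    have := (x.proj h₁).pathDist_le_vdist_add (y.proj h₁) w.1
    have := y.depth_nonneg
    rw [dist_def, dist_def]
    linarith

theorem proj_vertex (h₁ : G₁.Connected) (w : V₁ × V₂) :
    (vertex hL w).proj h₁ = vertex h₁ w.1 := by
  simp [proj, vertex]

theorem depth_eq_of_mid {x : GraphCoord hL} (h : x.fst.1 = x.snd.1) (hp : x.pos = 1 / 2) :
    x.depth = 1 / 2 := by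
  rw [depth_of_eq h, hp]
  norm_num

end GraphCoord

/-! ### The lower bound: an isometric copy of the first factor. -/

namespace MetricGraph

open GraphCoord

variable {V₁ V₂ : Type*} {G₁ : SimpleGraph V₁} {G₂ : SimpleGraph V₂}

/-- The copy `G₁ × {v}` of `G₁` in the lexicographic product. -/
def copyCoord {h₁ : G₁.Connected} (hL : (lexProd G₁ G₂).Connected) (v : V₂)
    (x : GraphCoord h₁) : GraphCoord hL where
  fst := (x.fst, v)
  snd := (x.snd, v)
  pos := x.pos
  valid := x.valid.imp (fun h => ⟨by rw [h.1], h.2⟩) (fun h => ⟨Or.inl h.1, h.2⟩)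

theorem dist_copyCoord {h₁ : G₁.Connected} (hL : (lexProd G₁ G₂).Connected) (v : V₂)
    (x y : GraphCoord h₁) : dist (copyCoord hL v x) (copyCoord hL v y) = dist x y := by
  have e : ∀ u u' : V₁, (u, v) = (u', v) ↔ u = u' := fun u u' => by simp
  rw [dist_def, dist_def]
  unfold pathDist
  by_cases h : x.fst = y.fst ∧ x.snd = y.snd
  · rw [if_pos h, if_pos ⟨(e _ _).2 h.1, (e _ _).2 h.2⟩]
    rfl
  rw [if_neg h, if_neg fun h' => h ⟨(e _ _).1 h'.1, (e _ _).1 h'.2⟩]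
  by_cases k : x.fst = y.snd ∧ x.snd = y.fst
  · rw [if_pos k, if_pos ⟨(e _ _).2 k.1, (e _ _).2 k.2⟩]
    rfl
  rw [if_neg k, if_neg fun k' => k ⟨(e _ _).1 k'.1, (e _ _).1 k'.2⟩]
  unfold vdist
  simp only [copyCoord, lexProd_dist_fiber h₁ hL]

theorem hyperbolicityConst_le_lexProd (h₁ : G₁.Connected) (hL : (lexProd G₁ G₂).Connected)
    (v : V₂) : hyperbolicityConst (MetricGraph h₁) ≤ hyperbolicityConst (MetricGraph hL) := by
  refine hyperbolicityConst_le_of_isometry (f := fun P => mk (copyCoord hL v P.coord)) ?_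
  refine Isometry.of_dist_eq fun P Q => ?_
  rw [dist_mk, dist_copyCoord, dist_coord]

end MetricGraph

/-! ### The projection on points and on long geodesics. -/

namespace MetricGraph

open GraphCoord

variable {V₁ V₂ : Type*} {G₁ : SimpleGraph V₁} {G₂ : SimpleGraph V₂}
  {hL : (lexProd G₁ G₂).Connected}

/-- The projection of the lexicographic product to its first factor. -/
noncomputable def proj (h₁ : G₁.Connected) (P : MetricGraph hL) : MetricGraph h₁ :=
  mk (P.coord.proj h₁)

/-- The depth of some coordinates of the point. -/
noncomputable def depth (P : MetricGraph hL) : ℝ := P.coord.depth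

theorem depth_nonneg (P : MetricGraph hL) : 0 ≤ P.depth := P.coord.depth_nonneg

theorem depth_le_half (P : MetricGraph hL) : P.depth ≤ 1 / 2 := P.coord.depth_le_half

theorem dist_proj_le (h₁ : G₁.Connected) (P Q : MetricGraph hL) :
    dist (P.proj h₁) (Q.proj h₁) ≤ max 0 (dist P Q - P.depth) := by
  unfold proj
  rw [dist_mk, ← dist_coord P Q]
  exact P.coord.dist_proj_le h₁ Q.coord

theorem dist_proj_le_dist (h₁ : G₁.Connected) (P Q : MetricGraph hL) :
    dist (P.proj h₁) (Q.proj h₁) ≤ dist P Q :=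
  (dist_proj_le h₁ P Q).trans
    (max_le dist_nonneg (by linarith [P.depth_nonneg]))

theorem proj_eq_of_dist_le {h₁ : G₁.Connected} {P Q : MetricGraph hL} (h : dist P Q ≤ P.depth) :
    P.proj h₁ = Q.proj h₁ :=
  dist_le_zero.1 ((dist_proj_le h₁ P Q).trans (max_le le_rfl (by linarith)))

theorem dist_le_max_dist_proj [Nontrivial V₁] (h₁ : G₁.Connected) (P Q : MetricGraph hL) :
    dist P Q ≤ max 2 (dist (P.proj h₁) (Q.proj h₁)) + P.depth + Q.depth := by
  unfold proj depth
  rw [dist_mk, ← dist_coord P Q]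
  exact P.coord.dist_le_max_dist_proj h₁ Q.coord

/-- The chosen coordinates do not matter: those at distance zero have projections at distance zero.
-/
theorem proj_mk (h₁ : G₁.Connected) (x : GraphCoord hL) : (mk x).proj h₁ = mk (x.proj h₁) := by
  refine mk_eq_mk ((GraphCoord.dist_proj_le h₁ _ _).trans (max_le le_rfl ?_))
  rw [← dist_mk, mk_coord, dist_self]
  linarith [(mk x).coord.depth_nonneg]

/-- The projection of a long geodesic is a geodesic, after removing the parts at both ends that
are collapsed. -/
theorem isGeodesicOn_proj [Nontrivial V₁] {h₁ : G₁.Connected} {γ : ℝ → MetricGraph hL} {a b : ℝ}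
    (hγ : IsGeodesicOn γ a b) (h : 2 < dist ((γ a).proj h₁) ((γ b).proj h₁)) :
    IsGeodesicOn (fun t => (γ t).proj h₁) (a + (γ a).depth) (b - (γ b).depth) ∧
      (γ (a + (γ a).depth)).proj h₁ = (γ a).proj h₁ ∧
      (γ (b - (γ b).depth)).proj h₁ = (γ b).proj h₁ := by
  have hd := hγ.dist_eq le_rfl hγ.1 le_rfl
  have hM := dist_le_max_dist_proj h₁ (γ a) (γ b)
  rw [max_eq_right h.le, hd] at hM
  have hle := dist_proj_le_dist h₁ (γ a) (γ b)
  rw [hd] at hle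
  have a0 := (γ a).depth_nonneg
  have b0 := (γ b).depth_nonneg
  have a1 := (γ a).depth_le_half
  have b1 := (γ b).depth_le_half
  have ea : (γ (a + (γ a).depth)).proj h₁ = (γ a).proj h₁ := by
    refine (proj_eq_of_dist_le ?_).symm
    rw [hγ.dist_eq le_rfl (by linarith) (by linarith)]
    linarith
  have eb : (γ (b - (γ b).depth)).proj h₁ = (γ b).proj h₁ := by
    refine (proj_eq_of_dist_le ?_).symm
    rw [dist_comm, hγ.dist_eq (by linarith) (by linarith) le_rfl]
    linarith
  -- By `hM`, the trimmed interval is no longer than the distance between the projected ends.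
  refine ⟨IsGeodesicOn.of_dist_le (by linarith) ?_ ?_, ea, eb⟩
  · intro s t hs hst ht
    rw [← hγ.dist_eq (by linarith) hst (by linarith)]
    exact dist_proj_le_dist h₁ _ _
  · rw [ea, eb]
    linarith

/-- A point of a geodesic far from its ends projects to a point of a geodesic, and its distance to
the ends is determined by the projection. -/
theorem exists_geodesic_proj_of_far [Nontrivial V₁] (h₁ : G₁.Connected) {S : Set (MetricGraph hL)}
    {X Y P : MetricGraph hL} (hS : IsGeodesicJoining S X Y) (hP : P ∈ S) (hX : 3 / 2 < dist P X)
    (hY : 3 / 2 < dist P Y) :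
    P.depth = 0 ∧ dist P X = dist (P.proj h₁) (X.proj h₁) + X.depth ∧
      dist P Y = dist (P.proj h₁) (Y.proj h₁) + Y.depth ∧
      ∃ S', IsGeodesicJoining S' (X.proj h₁) (Y.proj h₁) ∧ P.proj h₁ ∈ S' := by
  obtain ⟨γ, a, b, hγ, rfl, rfl, rfl⟩ := hS
  obtain ⟨t, ht, rfl⟩ := hP
  rw [dist_comm, hγ.dist_eq le_rfl ht.1 ht.2] at hX
  rw [hγ.dist_eq ht.1 ht.2 le_rfl] at hY
  have a0 := (γ a).depth_nonneg
  have b0 := (γ b).depth_nonneg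
  have a1 := (γ a).depth_le_half
  have b1 := (γ b).depth_le_half
  -- The ends are more than 3/2 + 3/2 apart and their depths total at most 1, which leaves more than
  -- 2.
  have h : 2 < dist ((γ a).proj h₁) ((γ b).proj h₁) := by
    have hM := dist_le_max_dist_proj h₁ (γ a) (γ b)
    rw [hγ.dist_eq le_rfl hγ.1 le_rfl] at hM
    have : 2 < max 2 (dist ((γ a).proj h₁) ((γ b).proj h₁)) := by linarith
    exact (lt_max_iff.1 this).resolve_left (lt_irrefl _)
  obtain ⟨hg, ea, eb⟩ := isGeodesicOn_proj hγ h
  refine ⟨?_, ?_, ?_, _, ⟨_, _, _, hg, ea, eb, rfl⟩, t, ⟨by linarith, by linarith⟩, rfl⟩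
  -- A positive depth would make the ends of `[t, t + depth]` project to one point, although this
  -- interval lies where the projection is a geodesic.
  · refine le_antisymm (not_lt.1 fun hpos => ?_) (γ t).depth_nonneg
    have p1 := (γ t).depth_le_half
    have e1 := hγ.dist_eq ht.1 (show t ≤ t + (γ t).depth by linarith) (by linarith)
    have e2 := hg.dist_eq (s := t) (t := t + (γ t).depth) (by linarith) (by linarith)
      (by linarith)
    have e3 : (γ t).proj h₁ = (γ (t + (γ t).depth)).proj h₁ :=
      proj_eq_of_dist_le (by linarith)
    simp only [e3, dist_self] at e2
    linarith
  · have e := hg.dist_eq (t := t) le_rfl (by linarith) (by linarith)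
    simp only [ea] at e
    rw [dist_comm, hγ.dist_eq le_rfl ht.1 ht.2, dist_comm, e]
    ring
  · have e := hg.dist_eq (s := t) (by linarith) (by linarith) le_rfl
    simp only [eb] at e
    rw [hγ.dist_eq ht.1 ht.2 le_rfl, e]
    ring

/-! ### Fibers and the vertices on the other sides. -/

/-- The copy of the second factor over the vertex `u`. -/
def fiber (hL : (lexProd G₁ G₂).Connected) (u : V₁) : Set (MetricGraph hL) :=
  Set.range fun v : V₂ => mk (vertex hL (u, v))

theorem vertex_mem_fiber (w : V₁ × V₂) : mk (vertex hL w) ∈ fiber hL w.1 := ⟨w.2, rfl⟩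

/-- A point at distance one from a fiber is a vertex of a neighbouring fiber. -/
theorem exists_vertex_of_infDist_fiber_eq_one {u : V₁} {Q : MetricGraph hL}
    (hQ : Metric.infDist Q (fiber hL u) = 1) :
    ∃ w, Q = mk (vertex hL w) ∧ G₁.Adj u w.1 := by
  have hne : (fiber hL u).Nonempty := by
    obtain ⟨w⟩ := hL.nonempty
    exact ⟨_, w.2, rfl⟩
  have hge : ∀ v, 1 ≤ Q.coord.vdist (u, v) := by
    intro v
    rw [← hQ, ← dist_vertex, ← dist_mk, mk_coord]
    exact Metric.infDist_le_dist_of_mem ⟨v, rfl⟩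
  have hlt : ∀ ε > 0, ∃ v, Q.coord.vdist (u, v) < 1 + ε := by
    intro ε hε
    obtain ⟨-, ⟨v, rfl⟩, h⟩ :=
      (Metric.infDist_lt_iff hne).1 (hQ.trans_lt (lt_add_of_pos_right 1 hε))
    refine ⟨v, ?_⟩
    rwa [← dist_vertex, ← dist_mk, mk_coord]
  have hend : Q.coord.pos = 0 ∨ Q.coord.pos = 1 := by
    by_contra! hne
    have h0 := lt_of_le_of_ne Q.coord.pos_nonneg (Ne.symm hne.1)
    have h1 := lt_of_le_of_ne Q.coord.pos_le_one hne.2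
    -- The infimum over a possibly infinite fiber is only approximated. From the interior of an
    -- edge, distances to vertices are either below 1 or at least 1 plus this minimum, so they
    -- cannot approach 1 from above.
    obtain ⟨v, hv⟩ := hlt (min Q.coord.pos (1 - Q.coord.pos)) (lt_min h0 (by linarith))
    have hm := min_le_left Q.coord.pos (1 - Q.coord.pos)
    have hm' := min_le_right Q.coord.pos (1 - Q.coord.pos)
    obtain ⟨e, s, he, hs⟩ := Q.coord.exists_isEnd_vdist (u, v)
    have hge := hge v
    have hs0 : 0 < s ∧ s < 1 ∧ min Q.coord.pos (1 - Q.coord.pos) ≤ s := by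
      rcases he with ⟨-, rfl⟩ | ⟨-, rfl⟩
      · exact ⟨h0, h1, hm⟩
      · exact ⟨by linarith, by linarith, hm'⟩
    rw [hs] at hv hge
    rcases Nat.eq_zero_or_pos ((lexProd G₁ G₂).dist e (u, v)) with hn | hn
    · rw [hn, Nat.cast_zero] at hge
      linarith
    · have h1n : (1 : ℝ) ≤ (lexProd G₁ G₂).dist e (u, v) := by exact_mod_cast hn
      linarith
  obtain ⟨w, hw⟩ : ∃ w, Q = mk (vertex hL w) := by
    rcases hend with h | h
    · exact ⟨_, by rw [← mk_eq_vertex_of_pos_eq_zero _ h, mk_coord]⟩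
    · exact ⟨_, by rw [← mk_eq_vertex_of_pos_eq_one _ h, mk_coord]⟩
  refine ⟨w, hw, ?_⟩
  have hd : ∀ v, Q.coord.vdist (u, v) = (lexProd G₁ G₂).dist w (u, v) := by
    intro v
    rw [← dist_vertex, ← dist_mk, mk_coord, hw, dist_mk, dist_vertex_vertex]
  obtain ⟨v, hv⟩ := hlt 1 one_pos
  have hv' := hge v
  rw [hd] at hv hv'
  have hone : (lexProd G₁ G₂).dist w (u, v) = 1 := by
    have h1 : 1 ≤ (lexProd G₁ G₂).dist w (u, v) := by exact_mod_cast hv'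
    have h2 : (lexProd G₁ G₂).dist w (u, v) < 2 := by
      have : ((lexProd G₁ G₂).dist w (u, v) : ℝ) < (2 : ℕ) := by push_cast; linarith
      exact_mod_cast this
    omega
  rcases SimpleGraph.dist_eq_one_iff_adj.1 hone with h | h
  · exact h.symm
  · have := vertex_mem_fiber (hL := hL) w
    rw [h.1, ← hw] at this
    rw [Metric.infDist_zero_of_mem this] at hQ
    exact absurd hQ zero_ne_one

/-- A point outside the interiors of the copies of the second factor is a vertex or lies on an
edge between two fibers; its coordinates may start at the closest end. -/
theorem exists_coord_of_depth_eq_zero {P : MetricGraph hL} (hP : P.depth = 0) :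
    ∃ c : GraphCoord hL, mk c = P ∧ c.pos ≤ 1 / 2 ∧ (c.fst = c.snd ∨ c.fst.1 ≠ c.snd.1) := by
  by_cases h : P.coord.fst.1 = P.coord.snd.1
  · have h0 : min P.coord.pos (1 - P.coord.pos) = 0 := (depth_of_eq h).symm.trans hP
    rcases min_choice P.coord.pos (1 - P.coord.pos) with hm | hm
    · refine ⟨vertex hL P.coord.fst, ?_, by simp [vertex], Or.inl rfl⟩
      rw [← mk_eq_vertex_of_pos_eq_zero _ (hm.symm.trans h0), mk_coord]
    · refine ⟨vertex hL P.coord.snd, ?_, by simp [vertex], Or.inl rfl⟩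
      rw [← mk_eq_vertex_of_pos_eq_one _ (by linarith), mk_coord]
  · rcases le_total P.coord.pos (1 / 2) with hp | hp
    · exact ⟨P.coord, mk_coord P, hp, Or.inr h⟩
    · have hadj : (lexProd G₁ G₂).Adj P.coord.fst P.coord.snd := Or.inl (adj_of_ne h)
      let c : GraphCoord hL := onEdge hL hadj.symm (1 - P.coord.pos)
        (by linarith [P.coord.pos_le_one]) (by linarith)
      refine ⟨c, ?_, show 1 - P.coord.pos ≤ 1 / 2 by linarith, Or.inr (Ne.symm h)⟩
      rw [← mk_coord P]
      refine mk_eq_mk ?_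
      rw [dist_of_opp (x := c) (y := P.coord) hadj.symm rfl rfl]
      simp [c, onEdge]

/-- If a geodesic starting far from `P` passes through a vertex, its distance to `P` is bounded by
the distance of the projections, or by `3 / 2`. -/
theorem exists_dist_le_of_vertex_mem {h₁ : G₁.Connected}
    {S : Set (MetricGraph hL)} {P X Z : MetricGraph hL} (hS : IsGeodesicJoining S X Z)
    (hP : P.depth = 0) (hPX : dist P X = dist (P.proj h₁) (X.proj h₁) + X.depth)
    (hX : 3 / 2 < dist P X) {w : V₁ × V₂} (hw : mk (vertex hL w) ∈ S) :
    ∃ r ∈ S, dist P r ≤ max (dist (P.proj h₁) (mk (vertex h₁ w.1))) (3 / 2) := by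
  obtain ⟨c, rfl, hc, hc'⟩ := exists_coord_of_depth_eq_zero hP
  have hadj1 : ∀ w' : V₁ × V₂, G₁.Adj c.fst.1 w'.1 →
      dist (mk c) (mk (vertex hL w')) ≤ 3 / 2 := by
    intro w' h
    rw [dist_mk, dist_vertex]
    have := c.isEnd_fst.vdist_le w'
    rw [lexProd_dist_eq_one _ _ h] at this
    linarith
  by_cases h1 : w.1 = c.fst.1
  -- Here `w` itself may be too far from `P`, so the geodesic is stopped at distance 1 from the
  -- fiber, at a vertex adjacent to `c.fst`. It starts at least that far away: otherwise d(πP, πX)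
  -- is at most 1/2, or less than 1/2 + (1 - depth X), and either way adding depth X contradicts
  -- `hX`.
  · have hfar : 1 ≤ Metric.infDist X (fiber hL c.fst.1) := by
      by_contra! hlt
      obtain ⟨-, ⟨v, rfl⟩, hv⟩ := (Metric.infDist_lt_iff ⟨_, vertex_mem_fiber _⟩).1 hlt
      have d1 := dist_proj_le h₁ X (mk (vertex hL (c.fst.1, v)))
      have d2 := dist_proj_le_dist h₁ (mk c) (mk (vertex hL c.fst))
      have d3 : dist (mk c) (mk (vertex hL c.fst)) ≤ c.pos := by
        rw [dist_mk, dist_vertex]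
        exact c.vdist_fst_le
      rw [proj_mk, proj_vertex] at d1
      change dist (X.proj h₁) (mk (vertex h₁ c.fst.1)) ≤ _ at d1
      change dist X (mk (vertex hL (c.fst.1, v))) < 1 at hv
      rw [proj_mk h₁ (vertex _ _), proj_vertex] at d2
      have d4 := dist_triangle_right ((mk c).proj h₁) (X.proj h₁) (mk (vertex h₁ c.fst.1))
      have d5 := X.depth_le_half
      rcases max_choice 0 (dist X (mk (vertex hL (c.fst.1, v))) - X.depth) with e | e <;>
        rw [e] at d1 <;> linarith
    obtain ⟨γ, a, b, hγ, rfl, rfl, rfl⟩ := hS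
    obtain ⟨t, ht, htw⟩ := hw
    have hcont : ContinuousOn (fun r => Metric.infDist (γ r) (fiber hL c.fst.1))
        (Set.uIcc a t) :=
      (Metric.continuous_infDist_pt _).comp_continuousOn (hγ.continuousOn.mono
        (Set.uIcc_subset_Icc ⟨le_rfl, hγ.1⟩ ht))
    have hzero : Metric.infDist (γ t) (fiber hL c.fst.1) = 0 :=
      Metric.infDist_zero_of_mem (by rw [htw, ← h1]; exact vertex_mem_fiber w)
    obtain ⟨r, hr, hr1⟩ := intermediate_value_uIcc hcont
      (show (1 : ℝ) ∈ _ from Set.mem_uIcc.2 (Or.inr ⟨by simp [hzero], hfar⟩))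
    obtain ⟨w', hw', hadj⟩ := exists_vertex_of_infDist_fiber_eq_one hr1
    refine ⟨γ r, ⟨r, Set.uIcc_subset_Icc ⟨le_rfl, hγ.1⟩ ht hr, rfl⟩, le_max_of_le_right ?_⟩
    rw [hw']
    exact hadj1 w' hadj
  refine ⟨_, hw, ?_⟩
  by_cases h2 : w.1 = c.snd.1
  · have hne : c.fst.1 ≠ c.snd.1 := fun h => h1 (h2.trans h.symm)
    exact le_max_of_le_right (hadj1 w (h2 ▸ adj_of_ne hne))
  · refine le_max_of_le_left ?_
    have hpos : (c.proj h₁).pos = c.pos := by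
      rcases hc' with h | h
      · rw [proj_pos_of_eq (congrArg Prod.fst h)]
        rcases c.valid with h' | h'
        · exact h'.2.symm
        · exact absurd h h'.1.ne
      · exact proj_pos_of_ne h
    rw [proj_mk, dist_mk, dist_mk, dist_vertex, dist_vertex]
    unfold vdist
    rw [hpos, lexProd_dist_eq h₁ hL (Ne.symm h1), lexProd_dist_eq h₁ hL (Ne.symm h2)]
    exact le_rfl

/-- Given a point `P` far from `X`, each geodesic `XZ` of the lexicographic product can be replaced
by a geodesic of the first factor without decreasing the distance to `P` by more than `3 / 2`. -/
theorem exists_geodesic_near [Nontrivial V₁] {h₁ : G₁.Connected}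
    {S : Set (MetricGraph hL)} {P X Z : MetricGraph hL} (hS : IsGeodesicJoining S X Z)
    (hP : P.depth = 0) (hPX : dist P X = dist (P.proj h₁) (X.proj h₁) + X.depth)
    (hX : 3 / 2 < dist P X) :
    ∃ S', IsGeodesicJoining S' (X.proj h₁) (Z.proj h₁) ∧
      ∀ q ∈ S', ∃ r ∈ S, dist P r ≤ dist (P.proj h₁) q + 3 / 2 := by
  -- It is thus enough to find, for each q, a vertex of the side whose projection is within 3/2 of
  -- q.
  have hvert : ∀ w q, mk (vertex hL w) ∈ S → dist q (mk (vertex h₁ w.1)) ≤ 3 / 2 →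
      ∃ r ∈ S, dist P r ≤ dist (P.proj h₁) q + 3 / 2 := by
    intro w q hw hq
    obtain ⟨r, hr, hd⟩ := exists_dist_le_of_vertex_mem hS hP hPX hX hw
    refine ⟨r, hr, hd.trans (max_le ?_ (by linarith [dist_nonneg (x := P.proj h₁) (y := q)]))⟩
    linarith [dist_triangle (P.proj h₁) q (mk (vertex h₁ w.1))]
  have hX0 := hS.left_mem
  obtain ⟨γ, a, b, hγ, rfl, rfl, rfl⟩ := hS
  have hd := hγ.dist_eq le_rfl hγ.1 le_rfl
  have hvnear : ∀ s ∈ Set.Icc a b, ∀ t ∈ Set.Icc a b, |s - t| = 1 →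
      ∃ w, mk (vertex hL w) ∈ γ '' Set.Icc a b ∧
        dist ((γ s).proj h₁) (mk (vertex h₁ w.1)) ≤ 1 := by
    intro s hs t ht hst
    obtain ⟨r, hr, w, hw, hle, -⟩ := exists_vertex_of_geodesic hγ hs ht hst
    refine ⟨w, hw ▸ ⟨r, hr, rfl⟩, ?_⟩
    rw [← proj_vertex (hL := hL), ← proj_mk, ← hw]
    refine (dist_proj_le_dist h₁ _ _).trans ?_
    rwa [hγ.2 s hs r hr]
  rcases lt_or_ge 2 (dist ((γ a).proj h₁) ((γ b).proj h₁)) with hlong | hshort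
  · obtain ⟨hg, ea, eb⟩ := isGeodesicOn_proj hγ hlong
    refine ⟨_, ⟨_, _, _, hg, ea, eb, rfl⟩, ?_⟩
    rintro - ⟨t, ht, rfl⟩
    have hlen := dist_proj_le_dist h₁ (γ a) (γ b)
    have htI : t ∈ Set.Icc a b :=
      ⟨by linarith [ht.1, (γ a).depth_nonneg], by linarith [ht.2, (γ b).depth_nonneg]⟩
    -- The geodesic is longer than 2, so there is room for a unit step in at least one direction.
    obtain ⟨s, hs, hst⟩ : ∃ s ∈ Set.Icc a b, |t - s| = 1 := by
      rcases le_total t (a + 1) with h | h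
      · exact ⟨t + 1, ⟨by linarith [htI.1], by linarith⟩, by simp⟩
      · exact ⟨t - 1, ⟨by linarith, by linarith [htI.2]⟩, by simp⟩
    obtain ⟨w, hw, hle⟩ := hvnear t htI s hs hst
    exact hvert w _ hw (hle.trans (by norm_num))
  · obtain ⟨S', hS'⟩ := exists_geodesic ((γ a).proj h₁) ((γ b).proj h₁)
    refine ⟨S', hS', fun q hq => ?_⟩
    have hsum := hS'.dist_add_dist hq
    have htri := dist_triangle (P.proj h₁) q ((γ a).proj h₁)
    rw [dist_comm q] at htri
    have hlen := dist_proj_le_dist h₁ (γ a) (γ b)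
    have hq0 : 0 ≤ dist q ((γ b).proj h₁) := dist_nonneg
    have haI : a ∈ Set.Icc a b := ⟨le_rfl, hγ.1⟩
    have hbI : b ∈ Set.Icc a b := ⟨hγ.1, le_rfl⟩
    have hdepth := (γ a).depth_le_half
    -- In this case `q` is within 1/2 of the projection of `γ b`, and the geodesic has a vertex
    -- projecting within 1 of that.
    by_cases h32 : 3 / 2 < dist ((γ a).proj h₁) q
    · obtain ⟨w, hw, hle⟩ := hvnear b hbI (b - 1) ⟨by linarith, by linarith⟩ (by simp)
      refine hvert w q hw ((dist_triangle q ((γ b).proj h₁) _).trans ?_)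
      linarith
    -- If this holds, the end `γ a` itself serves, by the exact formula `hPX`. Otherwise the depth
    -- is positive and the geodesic leaves a fiber edge through a vertex with the same projection as
    -- `γ a`.
    by_cases hsmall : dist ((γ a).proj h₁) q + (γ a).depth ≤ 3 / 2
    · exact ⟨_, hX0, by linarith⟩
    obtain ⟨r, hr, w, hw, hle, hm⟩ := exists_vertex_of_geodesic hγ haI
      (t := a + 1) ⟨by linarith, by linarith⟩ (by simp)
    refine hvert w q (hw ▸ ⟨r, hr, rfl⟩) ?_
    have hproj : (γ a).proj h₁ = mk (vertex h₁ w.1) := by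
      rw [← proj_vertex (hL := hL), ← proj_mk, ← hw]
      rcases hm with rfl | ⟨m, hm₁, hm₂, hm₃, hmd⟩
      · rfl
      have hcoord : (γ a).coord.fst.1 = (γ a).coord.snd.1 := by
        by_contra hne
        have : (γ a).depth = 0 := depth_of_ne hne
        linarith
      -- The comparison goes through the midpoint: the ball collapsed around `γ a` need not reach
      -- the vertex, but the one of radius 1/2 around `m` contains both.
      have hmdepth : m.depth = 1 / 2 := depth_eq_of_mid (by rw [hm₁, hm₂, hcoord]) hm₃
      have key : ∀ y : GraphCoord hL, dist m y ≤ 1 / 2 →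
          mk (m.proj h₁) = mk (y.proj h₁) := by
        intro y hy
        exact mk_eq_mk ((GraphCoord.dist_proj_le h₁ m y).trans (max_le le_rfl (by linarith)))
      have k1 := key _ hmd
      have k2 := key (γ a).coord (by
        rw [dist_of_same hm₁ hm₂, hm₃, abs_le]
        constructor <;> linarith [(γ a).coord.pos_nonneg, (γ a).coord.pos_le_one])
      rw [hw, proj_mk]
      exact k2.symm.trans k1
    rw [← hproj, dist_comm]
    exact not_lt.1 h32

/-! ### The upper bound. -/

/-- Each point of a side of a geodesic triangle in the lexicographic product is close to the
other two sides. -/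
theorem exists_dist_le_of_triangle [Nontrivial V₁] {h₁ : G₁.Connected} {δ : ℝ≥0}
    (hδ : hyperbolicityConst (MetricGraph h₁) = δ) {S₀ S₁ S₂ : Set (MetricGraph hL)}
    {X Y Z P : MetricGraph hL} (hS₀ : IsGeodesicJoining S₀ X Y) (hS₁ : IsGeodesicJoining S₁ Y Z)
    (hS₂ : IsGeodesicJoining S₂ Z X) (hP : P ∈ S₀) {ε : ℝ} (hε : 0 < ε) :
    ∃ r ∈ S₁ ∪ S₂, dist P r ≤ δ + 3 / 2 + ε := by
  have hδ0 : (0 : ℝ) ≤ δ := δ.coe_nonneg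
  by_cases hX : dist P X ≤ 3 / 2
  · exact ⟨X, Or.inr hS₂.right_mem, by linarith⟩
  by_cases hY : dist P Y ≤ 3 / 2
  · exact ⟨Y, Or.inl hS₁.left_mem, by linarith⟩
  rw [not_le] at hX hY
  obtain ⟨hdepth, hPX, hPY, T₀, hT₀, hPT⟩ := exists_geodesic_proj_of_far h₁ hS₀ hP hX hY
  obtain ⟨T₁, hT₁, near₁⟩ := exists_geodesic_near hS₁ hdepth hPY hY
  obtain ⟨T₂, hT₂, near₂⟩ := exists_geodesic_near hS₂.symm hdepth hPX hX
  obtain ⟨q, hq, hd⟩ := exists_dist_lt_of_hyperbolicityConst hδ hT₀ hT₁ hT₂.symm hPT hε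
  rcases hq with hq | hq
  · obtain ⟨r, hr, hle⟩ := near₁ q hq
    exact ⟨r, Or.inl hr, by linarith⟩
  · obtain ⟨r, hr, hle⟩ := near₂ q hq
    exact ⟨r, Or.inr hr, by linarith⟩

theorem hyperbolicityConst_lexProd_le [Nontrivial V₁] (h₁ : G₁.Connected)
    (hL : (lexProd G₁ G₂).Connected) :
    hyperbolicityConst (MetricGraph hL) ≤ hyperbolicityConst (MetricGraph h₁) + 3 / 2 := by
  by_cases htop : hyperbolicityConst (MetricGraph h₁) = ⊤
  · rw [htop, top_add]
    exact le_top
  obtain ⟨δ, hδ⟩ : ∃ δ : ℝ≥0, (δ : ℝ≥0∞) = _ := ⟨_, ENNReal.coe_toNNReal htop⟩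
  refine iSup_le fun T => ?_
  have hthin : T.IsThin (δ + 3 / 2) := by
    intro i p hp
    -- Thinness is a bound on an infimum distance, so the arbitrary slack `ε` costs nothing.
    refine le_of_forall_pos_le_add fun ε hε => ?_
    have h₃ : IsGeodesicJoining (T.side (i + 2)) (T.point (i + 2)) (T.point i) := by
      have := T.isGeodesic (i + 2)
      rwa [show i + 2 + 1 = i by fin_cases i <;> rfl] at this
    have h₂ : IsGeodesicJoining (T.side (i + 1)) (T.point (i + 1)) (T.point (i + 2)) := by
      have := T.isGeodesic (i + 1)
      rwa [show i + 1 + 1 = i + 2 by fin_cases i <;> rfl] at this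
    obtain ⟨r, hr, hd⟩ := exists_dist_le_of_triangle hδ.symm (T.isGeodesic i) h₂ h₃ hp hε
    have hmem : r ∈ ⋃ (j : Fin 3) (_ : j ≠ i), T.side j := by
      rcases hr with hr | hr
      · exact Set.mem_biUnion (show i + 1 ∈ {j | j ≠ i} by fin_cases i <;> simp) hr
      · exact Set.mem_biUnion (show i + 2 ∈ {j | j ≠ i} by fin_cases i <;> simp) hr
    refine (Metric.infDist_le_dist_of_mem hmem).trans (hd.trans ?_)
    push_cast
    exact le_rfl
  refine (iInf₂_le (δ + 3 / 2) hthin).trans ?_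
  rw [← hδ, ENNReal.coe_add, ENNReal.coe_div two_ne_zero]
  exact le_rfl

end MetricGraph

theorem theoremt {V₁ V₂ : Type*} (G₁ : SimpleGraph V₁) (G₂ : SimpleGraph V₂)
    (h₁ : G₁.Connected) (h₂ : G₂.Connected) (hnt : Nontrivial V₁) :
    hyperbolicityConst (MetricGraph h₁) ≤
        hyperbolicityConst (MetricGraph (lexProd_connected h₁ h₂)) ∧
      hyperbolicityConst (MetricGraph (lexProd_connected h₁ h₂)) ≤
        hyperbolicityConst (MetricGraph h₁) + 3 / 2 := by
  obtain ⟨v⟩ := h₂.nonempty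
  exact ⟨MetricGraph.hyperbolicityConst_le_lexProd h₁ _ v,
    MetricGraph.hyperbolicityConst_lexProd_le h₁ _⟩
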